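/- Let $G$ be a locally compact second countable (Hausdorff) topological group, $H\le G$ a closed subgroup, $\Gamma\le G$ a discrete subgroup, $o\in G/H$ the identity coset, and let $\mathrm m_G$, $\mathrm m_H$ be left Haar measures on $G$ and $H$. For a closed subgroup $K$ of a locally compact group $L$, call measures $(\mathrm m_L,\mathrm m_K,\mathrm m_{L/K})$ on $L,K,L/K$ compatible if $\int_L f\,d\mathrm m_L=\int_{L/K}\int_K f(gk)\,d\mathrm m_K(k)\,d\mathrm m_{L/K}([g])$ for all $f\in C_c(L)$. Assume: (1) $\mathrm m_{[G]}$ is a $G$-invariant locally finite measure on $G/\Gamma$, compatible with $\mathrm m_G$ and the counting measure on $\Gamma$; (2) $H\Gamma/\Gamma$ is closed in $G/\Gamma$, and $\mathrm m_{[H]}$ is an $H$-invariant locally finite measure on $H\Gamma/\Gamma\cong H/(H\cap\Gamma)$ (viewed as a measure on $G/\Gamma$), compatible with $\mathrm m_H$ and the counting measure on $H\cap\Gamma$; (3) $\mathrm m_{G/H}$ is a $G$-invariant locally finite measure on $G/H$ such that $(\mathrm m_G,\mathrm m_H,\mathrm m_{G/H})$ is compatible. Let $l:G/H\to\mathbb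 R_{>0}$ be continuous, put $B_R=\{x\in G/H: l(x)\le R\}$, and assume $\mathrm m_{G/H}(B_R)<\infty$ for every $R>0$. Assume that for every $0<\varepsilon<1$ there is an open neighbourhood $\mathcal O_\varepsilon$ of $\mathrm{id}\in G$ such that $$(1-\varepsilon)\,\mathrm m_{G/H}\Big(\bigcup_{g\in\mathcal O_\varepsilon}gB_R\Big)\le \mathrm m_{G/H}(B_R)\le(1+\varepsilon)\,\mathrm m_{G/H}\Big(\bigcap_{g\in\mathcal O_\varepsilon}gB_R\Big)\quad\text{for all }R\ge1,$$ $$B_{(1-\varepsilon)R}\subset\bigcap_{g\in\mathcal O_\varepsilon}gB_R\subset\bigcup_{g\in\mathcal O_\varepsilon}gB_R\subset B_{(1+\varepsilon)R}\quad\text{for all }R>1.$$ Let $w:G/H\to\mathbb R_{>0}$ be such that for every $\varepsilon>0$ there is an open neighbourhood $\mathcal O$ of $\mathrm{id}$ with $(1-\varepsilon)w_{gx}\le w_x\le(1+\varepsilon)w_{gx}$ for all $x\in G/H$, $g\in\mathcal O$. Let $(C_R)_{R\ge1}$ be positive reals for which there are $c_1>0$, $c_2,c_3\ge0$ with $c_1R^{c_2}(\log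 R)^{c_3}/C_R\to1$ as $R\to+\infty$. Define $$\Phi^w_R([g])=\frac1{C_R}\sum_{x\in g\Gamma.o\cap B_R}w_x\quad([g]\in G/\Gamma),\qquad \mu_R=\frac1{C_R}\int_{[g]\in B_R}w_{g.o}\;g_*\mathrm m_{[H]}\;d\mathrm m_{G/H}([g]).$$ Let $\mu_\infty$ be a locally finite measure on $G/\Gamma$. (a) Suppose that $\mu_\infty\neq0$ and $\mu_R\to\mu_\infty$ as $R\to\infty$ in the weak-$*$ topology, i.e. for every $\varphi\in C_c(G/\Gamma)$, $\varphi$ is $\mu_R$-integrable for all large $R$ and $\int\varphi\,d\mu_R\to\int\varphi\,d\mu_\infty$. Then there is a continuous function $f_\infty:G/\Gamma\to\mathbb R_{\ge0}$ such that $\mu_\infty=f_\infty\cdot\mathrm m_{[G]}$ and, for every $[g]\in G/\Gamma$, the sums defining $\Phi^w_R([g])$ converge and $\lim_{R\to\infty}\Phi^w_R([g])=f_\infty([g])$. If $G/\Gamma$ is connected (in particular, if $G$ is connected), then $f_\infty$ is strictly positive everywhere. (b) Let $U\subset G/\Gamma$ be an open neighbourhood of the identity coset and suppose that the convergence in (a)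 holds for those $\varphi\in C_c(G/\Gamma)$ whose support is contained in $U$. Then there is a function $f_\infty$, continuous and non-negative on $U$, such that $\mu_\infty|_U=f_\infty\cdot\mathrm m_{[G]}|_U$ and, for every $[g]\in U$, the sums defining $\Phi^w_R([g])$ converge and $\lim_{R\to\infty}\Phi^w_R([g])=f_\infty([g])$. -/

import Mathlib

open MeasureTheory Filter Topology
open scoped Pointwise ENNReal

noncomputable section

namespace OrbitCounting

/-- The triple `(mL, mK, mLK)` of measures on `L`, `K`, `L ⧸ K` is compatible:
`∫ f dmL = ∫ ∫ f (g k) dmK(k) dmLK([g])` for all continuous compactly supported `f`. It is only used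
for left-invariant `mK`, and then the inner integral depends only on the coset `[g]`, so that it may
be evaluated at the representative `q.out`. -/
def IsCompatibleTriple {L : Type*} [Group L] [TopologicalSpace L] [MeasurableSpace L]
    (K : Subgroup L) (mL : Measure L) (mK : Measure K) (mLK : Measure (L ⧸ K)) : Prop :=
  ∀ f : L → ℝ, Continuous f → HasCompactSupport f →
    ∫ x, f x ∂mL = ∫ q : L ⧸ K, ∫ k : K, f (q.out * (k : L)) ∂mK ∂mLK

section Group

variable {G : Type*} [Group G]

/-- The natural map `H ⧸ (H ∩ Γ) → G ⧸ Γ`, `h (H ∩ Γ) ↦ h Γ`, with image `HΓ/Γ`. -/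
def orbitMap (H Γ : Subgroup G) : H ⧸ Γ.subgroupOf H → G ⧸ Γ :=
  Quotient.lift (fun h : H => ((h : G) : G ⧸ Γ)) (by
    intro a b hab
    have h := QuotientGroup.leftRel_apply.mp hab
    rw [Subgroup.mem_subgroupOf] at h
    exact QuotientGroup.eq.mpr (by simpa using h))

/-- The sublevel set `B_R = {x ∈ G/H | l x ≤ R}`. -/
def heightBall {H : Subgroup G} (l : G ⧸ H → ℝ) (R : ℝ) : Set (G ⧸ H) := {x | l x ≤ R}

/-- For `y = gΓ`, the set `gΓ.o ⊆ G/H`, where `o` is the identity coset of `G/H`. -/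
def orbitPoints (H : Subgroup G) {Γ : Subgroup G} (y : G ⧸ Γ) : Set (G ⧸ H) :=
  {x | ∃ g : G, (g : G ⧸ Γ) = y ∧ (g : G ⧸ H) = x}

/-- The normalized weighted orbit count
`Φ_R([g]) = (1 / C_R) ∑_{x ∈ gΓ.o ∩ B_R} w x`. -/
def weightedCount {H Γ : Subgroup G} (l w : G ⧸ H → ℝ) (C : ℝ → ℝ) (R : ℝ) (y : G ⧸ Γ) : ℝ :=
  1 / C R * ∑' x : ↥(orbitPoints H y ∩ heightBall l R), w x

/-- `(C_R)_{R ≥ 1}` is a family of positive numbers with a polynomial asymptotic. -/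
def HasPolynomialAsymptotic (C : ℝ → ℝ) : Prop :=
  (∀ R, 1 ≤ R → 0 < C R) ∧
    ∃ c₁ c₂ c₃ : ℝ, 0 < c₁ ∧ 0 ≤ c₂ ∧ 0 ≤ c₃ ∧
      Tendsto (fun R : ℝ => c₁ * R ^ c₂ * Real.log R ^ c₃ / C R) atTop (𝓝 1)

end Group

section Measures

variable {G : Type*} [Group G] [TopologicalSpace G] [MeasurableSpace G]

/-- The standing assumption on the invariant measures. `mG` and `mH` are left Haar measures on `G`
and `H`; `mGH`, `mGΓ` are measures on `G/H`, `G/Γ`; `mHΓ` is the measure `m_[H]`, which lives on the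
closed subset `HΓ/Γ` and is regarded as a measure on `G/Γ`. -/
structure InvariantMeasures (H Γ : Subgroup G) (mG : Measure G) (mH : Measure H)
    (mGH : Measure (G ⧸ H)) (mGΓ mHΓ : Measure (G ⧸ Γ)) : Prop where
  haar_G : mG.IsHaarMeasure
  haar_H : mH.IsHaarMeasure
  /-- `m_[G]` is `G`-invariant, locally finite and induced by `mG`. -/
  invariant_GΓ : SMulInvariantMeasure G (G ⧸ Γ) mGΓ
  locallyFinite_GΓ : IsLocallyFiniteMeasure mGΓ
  compatible_GΓ : IsCompatibleTriple Γ mG Measure.count mGΓ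
  /-- `HΓ/Γ` is closed and `m_[H]` is an `H`-invariant locally finite measure on it, induced by
  `mH` through the identification of `HΓ/Γ` with `H/(H ∩ Γ)`. -/
  closed_orbit : IsClosed (Set.range (orbitMap H Γ))
  invariant_HΓ : ∀ h ∈ H, mHΓ.map (fun y => h • y) = mHΓ
  locallyFinite_HΓ : IsLocallyFiniteMeasure mHΓ
  compatible_HΓ : ∃ ν : Measure (H ⧸ Γ.subgroupOf H),
    IsCompatibleTriple (Γ.subgroupOf H) mH Measure.count ν ∧ mHΓ = ν.map (orbitMap H Γ)
  /-- `m_{G/H}` is `G`-invariant, locally finite and compatible with `mG` and `mH`. -/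
  invariant_GH : SMulInvariantMeasure G (G ⧸ H) mGH
  locallyFinite_GH : IsLocallyFiniteMeasure mGH
  compatible_GH : IsCompatibleTriple H mG mH mGH

/-- The family `(B_R)` is well-rounded, and the neighbourhoods can moreover be chosen with
`B_{(1-ε)R} ⊆ ⋂ g B_R ⊆ ⋃ g B_R ⊆ B_{(1+ε)R}`. -/
def IsStronglyWellRounded {H : Subgroup G} (mGH : Measure (G ⧸ H)) (l : G ⧸ H → ℝ) : Prop :=
  ∀ ε : ℝ, 0 < ε → ε < 1 → ∃ O : Set G, IsOpen O ∧ (1 : G) ∈ O ∧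
    (∀ R : ℝ, 1 ≤ R →
      ENNReal.ofReal (1 - ε) * mGH (⋃ g ∈ O, g • heightBall l R) ≤ mGH (heightBall l R) ∧
      mGH (heightBall l R) ≤ ENNReal.ofReal (1 + ε) * mGH (⋂ g ∈ O, g • heightBall l R)) ∧
    (∀ R : ℝ, 1 < R →
      heightBall l ((1 - ε) * R) ⊆ ⋂ g ∈ O, g • heightBall l R ∧
      (⋂ g ∈ O, g • heightBall l R) ⊆ (⋃ g ∈ O, g • heightBall l R) ∧
      (⋃ g ∈ O, g • heightBall l R) ⊆ heightBall l ((1 + ε) * R))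

/-- The weight function varies slowly, uniformly on `G/H`. -/
def IsSlowlyVarying {H : Subgroup G} (w : G ⧸ H → ℝ) : Prop :=
  ∀ ε : ℝ, 0 < ε → ∃ O : Set G, IsOpen O ∧ (1 : G) ∈ O ∧
    ∀ x : G ⧸ H, ∀ g ∈ O, (1 - ε) * w (g • x) ≤ w x ∧ w x ≤ (1 + ε) * w (g • x)

/-- The measure `(1 / C_R) ∫_{[g] ∈ B_R} w_{g.o} g_* m_[H] dm_{G/H}([g])` on `G/Γ`. As `m_[H]` is
`H`-invariant, `g_* m_[H]` depends only on the coset `[g]`. -/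
def averagedTranslates {H Γ : Subgroup G} (mGH : Measure (G ⧸ H)) (mHΓ : Measure (G ⧸ Γ))
    (l w : G ⧸ H → ℝ) (C : ℝ → ℝ) (R : ℝ) : Measure (G ⧸ Γ) :=
  ENNReal.ofReal (1 / C R) • (mGH.restrict (heightBall l R)).bind
    (fun x => ENNReal.ofReal (w x) • mHΓ.map (fun y => x.out • y))

/-- Weak-* convergence `μ_R → μ` as `R → ∞`, tested against the continuous compactly supported
functions whose support lies in `U`; each of them has to be `μ_R`-integrable for large `R`, as is
the case when the `μ_R` are locally finite. -/
def WeakStarTendstoOn {X : Type*} [TopologicalSpace X] [MeasurableSpace X] (U : Set X)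
    (μR : ℝ → Measure X) (μ : Measure X) : Prop :=
  ∀ f : X → ℝ, Continuous f → HasCompactSupport f → tsupport f ⊆ U →
    (∀ᶠ R in atTop, Integrable f (μR R)) ∧
      Tendsto (fun R => ∫ x, f x ∂(μR R)) atTop (𝓝 (∫ x, f x ∂μ))

end Measures

end OrbitCounting

end

/-! Unfolding over `Γ` and over `H` gives ∫ φ Φ_R dm_[G] = ∫ φ dμ_R for measurable φ ≥ 0
(`InvariantMeasures.lintegral_averagedTranslates`, resting on
`InvariantMeasures.lintegral_mul_orbitSum`). So Φ_R is the density of μ_R with respect to m_[G], and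
the hypothesis is weak-* convergence of these densities.

Pointwise convergence comes from the regularity of Φ_R. Moving the base point by a small group
element moves B_R inside B_{(1+ε)R} and changes w by a factor at most 1+ε, while C_{aR}/C_R →
a^{c₂}. Hence for each K > 1 there is a scale a with Φ_R(z) ≤ K Φ_{aR}(y) and Φ_R(y) ≤ K Φ_{aR}(z)
for z near y and all large R (`isSlowlyVaryingFamily_orbitCount`). The scale a does no harm, since a
limit as R → ∞ does not see it.

Integrate these bounds against a bump φ near y, with p = ∫ φ dm_[G] and q = ∫ φ dμ_∞. This gives
limsup Φ_R(y) ≤ K q/p and q/p ≤ K liminf Φ_R(y), and K → 1 yields a finite limit f(y). The bounds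
pass to f: it is continuous and its zero set is open. Dominated convergence identifies f as the
density of μ_∞. -/

noncomputable section

namespace OrbitCounting

/-! ### Borel structure on quotients by closed subgroups -/

section Topology

variable {G : Type*} [Group G] [TopologicalSpace G] [IsTopologicalGroup G]
    [T2Space G] [LocallyCompactSpace G] [SecondCountableTopology G]

/-- A locally compact second countable Hausdorff group is Polish. -/
theorem polishSpace_of_locallyCompact : PolishSpace G := by
  let _ : UniformSpace G := IsTopologicalGroup.rightUniformSpace G
  have : (uniformity G).IsCountablyGenerated := by
    change (comap (fun p : G × G => p.2 * p.1⁻¹) (𝓝 (1 : G))).IsCountablyGenerated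
    infer_instance
  have : IsRightUniformGroup G := { ‹IsTopologicalGroup G› with uniformity_eq := rfl }
  have : CompleteSpace G := IsRightUniformGroup.completeSpace_of_weaklyLocallyCompactSpace
  infer_instance

variable [MeasurableSpace G] [BorelSpace G]

theorem borelSpace_quotient (H : Subgroup G) [IsClosed (H : Set G)] : BorelSpace (G ⧸ H) :=
  have : PolishSpace G := polishSpace_of_locallyCompact
  inferInstance

end Topology

/-! ### Translates of an `H`-invariant measure, indexed by cosets -/

section CosetTranslates

variable {G X : Type*} [Group G] [MeasurableSpace G] [MeasurableSpace X] [MulAction G X]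
  [MeasurableSMul₂ G X] {H : Subgroup G}

theorem map_out_smul {ρ : Measure X} (hρ : ∀ h ∈ H, ρ.map (fun y => h • y) = ρ) (g : G) :
    ρ.map (fun y => (g : G ⧸ H).out • y) = ρ.map (fun y => g • y) := by
  obtain ⟨h, hh⟩ := QuotientGroup.mk_out_eq_mul H g
  rw [hh]
  conv_rhs => rw [← hρ h h.2]
  rw [Measure.map_map (measurable_const_smul _) (measurable_const_smul _)]
  simp [Function.comp_def, mul_smul]

theorem measurable_map_smul (ρ : Measure X) [SFinite ρ] :
    Measurable (fun g : G => ρ.map (fun y => g • y)) := by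
  refine Measure.measurable_of_measurable_coe _ fun s hs => ?_
  have : MeasurableSet ((fun p : G × X => p.1 • p.2) ⁻¹' s) := measurable_smul hs
  convert measurable_measure_prodMk_left (ν := ρ) this using 2 with g
  exact Measure.map_apply (measurable_const_smul _) hs

/-- The choice `q.out` need not be measurable. By invariance the translate depends only on the
coset, so measurability can be checked after pulling back to `G`. -/
theorem measurable_map_out_smul {ρ : Measure X} [SFinite ρ]
    (hρ : ∀ h ∈ H, ρ.map (fun y => h • y) = ρ) :
    Measurable (fun q : G ⧸ H => ρ.map (fun y => q.out • y)) := by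
  rw [QuotientGroup.measurable_from_quotient]
  convert measurable_map_smul (G := G) ρ using 2 with g
  exact map_out_smul hρ g

end CosetTranslates

/-! ### Compatible triples: from continuous functions to nonnegative measurable ones -/

section Compatible

variable {L : Type*} [Group L] [TopologicalSpace L] [IsTopologicalGroup L]
    [MeasurableSpace L] [BorelSpace L] {K : Subgroup L}

theorem map_coe_smul_eq (mK : Measure K) [mK.IsMulLeftInvariant] :
    ∀ h ∈ K, (mK.map ((↑) : K → L)).map (fun y => h • y) = mK.map ((↑) : K → L) := by
  intro h hh
  conv_rhs => rw [← map_mul_left_eq_self mK ⟨h, hh⟩]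
  rw [Measure.map_map (measurable_const_smul _) measurable_subtype_coe,
    Measure.map_map measurable_subtype_coe (measurable_const_mul _)]
  rfl

theorem lintegral_map_coe_smul (mK : Measure K) {f : L → ℝ≥0∞} (hf : Measurable f) (g : L) :
    ∫⁻ x, f x ∂((mK.map ((↑) : K → L)).map (fun y => g • y)) = ∫⁻ k : K, f (g * k) ∂mK := by
  rw [lintegral_map hf (measurable_const_smul _)]
  exact lintegral_map (hf.comp (measurable_const_smul _)) measurable_subtype_coe

/-- The measure on `L` which integrates first over the cosets of `K` and then over `L ⧸ K`. -/
def cosetIntegral (mK : Measure K) (mLK : Measure (L ⧸ K)) : Measure L :=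
  mLK.bind fun q => (mK.map ((↑) : K → L)).map (fun y => q.out • y)

variable [SecondCountableTopology L]

theorem lintegral_cosetIntegral (mK : Measure K) [SFinite mK] [mK.IsMulLeftInvariant]
    (mLK : Measure (L ⧸ K)) {f : L → ℝ≥0∞} (hf : Measurable f) :
    ∫⁻ x, f x ∂(cosetIntegral mK mLK) = ∫⁻ q, ∫⁻ k : K, f (q.out * k) ∂mK ∂mLK := by
  rw [cosetIntegral, Measure.lintegral_bind
    (measurable_map_out_smul (map_coe_smul_eq mK)).aemeasurable hf.aemeasurable]
  refine lintegral_congr fun q => ?_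
  exact lintegral_map_coe_smul mK hf _

theorem measurable_lintegral_out_mul (mK : Measure K) [SFinite mK] [mK.IsMulLeftInvariant]
    {f : L → ℝ≥0∞} (hf : Measurable f) :
    Measurable fun q : L ⧸ K => ∫⁻ k : K, f (q.out * k) ∂mK := by
  convert (Measure.measurable_lintegral hf).comp
    (measurable_map_out_smul (map_coe_smul_eq mK)) using 2 with q
  symm
  exact lintegral_map_coe_smul mK hf _

variable [T2Space L] [LocallyCompactSpace L]

/-- Only cosets in the compact image of `S` contribute. If `q.out * k₀ ∈ S`, then every `k` with
`q.out * k ∈ S` satisfies `k₀⁻¹ * k ∈ S⁻¹ * S`, so the inner mass is at most that of a fixed compact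
subset of `K`. -/
theorem cosetIntegral_lt_top_of_isCompact [IsClosed (K : Set L)] (mK : Measure K) [SFinite mK]
    [mK.IsMulLeftInvariant] [IsFiniteMeasureOnCompacts mK] (mLK : Measure (L ⧸ K))
    [IsLocallyFiniteMeasure mLK] {S : Set L} (hS : IsCompact S) :
    cosetIntegral mK mLK S < ∞ := by
  have := borelSpace_quotient K
  have hmS : MeasurableSet S := hS.isClosed.measurableSet
  set T : Set K := (↑) ⁻¹' (S⁻¹ * S) with hT
  have hTc : IsCompact T :=
    (IsClosed.isClosedEmbedding_subtypeVal ‹_›).isCompact_preimage (hS.inv.mul hS)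
  have hπS : IsCompact ((↑) '' S : Set (L ⧸ K)) := hS.image QuotientGroup.continuous_mk
  have key : ∀ q : L ⧸ K, mK {k : K | q.out * (k : L) ∈ S} ≤
      Set.indicator ((↑) '' S : Set (L ⧸ K)) (fun _ => mK T) q := by
    intro q
    rcases Set.eq_empty_or_nonempty {k : K | q.out * (k : L) ∈ S} with h | ⟨k₀, hk₀⟩
    · simp [h]
    · have hq : q ∈ ((↑) '' S : Set (L ⧸ K)) :=
        ⟨_, hk₀, by rw [QuotientGroup.mk_mul_of_mem _ k₀.2]; exact Quotient.out_eq' q⟩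
      rw [Set.indicator_of_mem hq, ← measure_preimage_mul mK k₀]
      refine measure_mono fun k hk => ?_
      refine Set.mem_mul.mpr ⟨(q.out * k₀)⁻¹, Set.inv_mem_inv.mpr hk₀, _, hk, ?_⟩
      simp [mul_assoc]
  calc cosetIntegral mK mLK S = ∫⁻ x, S.indicator 1 x ∂(cosetIntegral mK mLK) := by
        rw [lintegral_indicator_one hmS]
    _ = ∫⁻ q, mK {k : K | q.out * (k : L) ∈ S} ∂mLK := by
        rw [lintegral_cosetIntegral mK mLK (measurable_one.indicator hmS)]
        refine lintegral_congr fun q => ?_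
        rw [← lintegral_indicator_one
          (show MeasurableSet {k : K | q.out * (k : L) ∈ S} from
            (measurable_const_mul q.out).comp measurable_subtype_coe hmS)]
        rfl
    _ ≤ ∫⁻ q, Set.indicator ((↑) '' S : Set (L ⧸ K)) (fun _ => mK T) q ∂mLK := lintegral_mono key
    _ = mK T * mLK ((↑) '' S) := by
        rw [lintegral_indicator_const hπS.isClosed.measurableSet]
    _ < ∞ := ENNReal.mul_lt_top hTc.measure_lt_top hπS.measure_lt_top

theorem regular_of_isFiniteMeasureOnCompacts {X : Type*} [TopologicalSpace X] [T2Space X]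
    [LocallyCompactSpace X] [SecondCountableTopology X] [MeasurableSpace X] [BorelSpace X]
    (μ : Measure X) [IsFiniteMeasureOnCompacts μ] : μ.Regular := by
  let _ := TopologicalSpace.metrizableSpaceMetric X
  infer_instance

/-- The compatibility formula, for all nonnegative measurable functions. -/
theorem IsCompatibleTriple.lintegral_eq [IsClosed (K : Set L)] {mL : Measure L} {mK : Measure K}
    [SFinite mK] [mK.IsMulLeftInvariant] [IsFiniteMeasureOnCompacts mK]
    [IsFiniteMeasureOnCompacts mL] {mLK : Measure (L ⧸ K)} [IsLocallyFiniteMeasure mLK]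
    (h : IsCompatibleTriple K mL mK mLK) {f : L → ℝ≥0∞} (hf : Measurable f) :
    ∫⁻ x, f x ∂mL = ∫⁻ q, ∫⁻ k : K, f (q.out * k) ∂mK ∂mLK := by
  have := borelSpace_quotient K
  have : IsFiniteMeasureOnCompacts (cosetIntegral mK mLK) :=
    ⟨fun S hS => cosetIntegral_lt_top_of_isCompact mK mLK hS⟩
  have := regular_of_isFiniteMeasureOnCompacts mL
  have := regular_of_isFiniteMeasureOnCompacts (cosetIntegral mK mLK)
  suffices hm : mL = cosetIntegral mK mLK by
    rw [← lintegral_cosetIntegral mK mLK hf, hm]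
  -- Both measures are regular, so by Riesz uniqueness it suffices to compare integrals of compactly
  -- supported continuous functions.
  refine Measure.ext_of_integral_eq_on_compactlySupported_nnreal fun φ => ?_
  have hφm : Measurable fun x => (φ x : ℝ≥0∞) :=
    (map_continuous φ).measurable.coe_nnreal_ennreal
  have hφc : HasCompactSupport fun x => (φ x : ℝ) := φ.hasCompactSupport.comp_left rfl
  have hφ : Continuous fun x => (φ x : ℝ) := by fun_prop
  have inner : ∀ q : L ⧸ K,
      ∫ k : K, (φ (q.out * k) : ℝ) ∂mK = (∫⁻ k : K, (φ (q.out * k) : ℝ≥0∞) ∂mK).toReal := by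
    intro q
    rw [integral_eq_lintegral_of_nonneg_ae (by filter_upwards with k using by positivity)
      (by fun_prop : Continuous fun k : K => (φ (q.out * k) : ℝ)).aestronglyMeasurable]
    simp
  -- Finiteness matters because `toReal` would turn an infinite inner integral into 0.
  have innerfin : ∀ q : L ⧸ K, ∫⁻ k : K, (φ (q.out * k) : ℝ≥0∞) ∂mK ≠ ∞ := by
    intro q
    have hc : HasCompactSupport fun k : K => (φ (q.out * k) : ℝ) := by
      have : IsClosedEmbedding fun k : K => q.out * (k : L) :=
        (Homeomorph.mulLeft q.out).isClosedEmbedding.comp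
          (IsClosed.isClosedEmbedding_subtypeVal ‹_›)
      exact hφc.comp_isClosedEmbedding this
    have hcont : Continuous fun k : K => (φ (q.out * k) : ℝ) := by fun_prop
    have hi := hcont.integrable_of_hasCompactSupport
      (μ := mK) hc
    have := hi.2
    simpa [HasFiniteIntegral, enorm] using this.ne
  rw [h _ hφ hφc]
  simp_rw [inner]
  rw [integral_eq_lintegral_of_nonneg_ae (μ := cosetIntegral mK mLK)
      (by filter_upwards with k using by positivity) hφ.aestronglyMeasurable,
    integral_eq_lintegral_of_nonneg_ae (by filter_upwards with k using by positivity)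
      (measurable_lintegral_out_mul mK hφm).ennreal_toReal.aestronglyMeasurable]
  congr 1
  simp only [ENNReal.ofReal_coe_nnreal]
  rw [lintegral_cosetIntegral mK mLK hφm]
  exact lintegral_congr fun q => ENNReal.ofReal_toReal (innerfin q)

end Compatible

/-! ### Fundamental domains of discrete subgroups -/

section Discrete

variable {G : Type*} [Group G] [TopologicalSpace G] [IsTopologicalGroup G]

/-- A discrete subgroup of a separable group has a Borel fundamental domain; here it is given by
its indicator function. -/
theorem exists_measurable_tsum_mul_eq_one [TopologicalSpace.SeparableSpace G] [MeasurableSpace G]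
    [BorelSpace G] (D : Subgroup G) [DiscreteTopology D] :
    ∃ b : G → ℝ≥0∞, Measurable b ∧ ∀ g : G, ∑' d : D, b (g * d) = 1 := by
  obtain ⟨W, hWo, hW⟩ := isOpen_induced_iff.mp (isOpen_discrete ({1} : Set D))
  have hW1 : (1 : G) ∈ W := by
    have : (1 : D) ∈ ((↑) : D → G) ⁻¹' W := by rw [hW]; rfl
    exact this
  have hWD : ∀ d ∈ D, d ∈ W → d = 1 := by
    intro d hd hdW
    have : (⟨d, hd⟩ : D) ∈ ((↑) : D → G) ⁻¹' W := hdW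
    rw [hW] at this
    exact congrArg Subtype.val this
  have hcont : Tendsto (fun p : G × G => p.1⁻¹ * p.2) (𝓝 (1, 1)) (𝓝 (1 : G)) := by
    have : Continuous fun p : G × G => p.1⁻¹ * p.2 := by fun_prop
    simpa using this.tendsto (1, 1)
  have hmem := hcont (hWo.mem_nhds hW1)
  rw [nhds_prod_eq] at hmem
  obtain ⟨V', hV', hV'W⟩ := mem_prod_same_iff.mp hmem
  obtain ⟨V, hVV', hVo, hV1⟩ := mem_nhds_iff.mp hV'
  set s := TopologicalSpace.denseSeq G
  set A : ℕ → Set G := fun i => {g | (s i)⁻¹ * g ∈ V}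
  have hA : ∀ i, IsOpen (A i) := fun i => hVo.preimage (continuous_const_mul _)
  set B : ℕ → Set G := fun i => ⋃ d : D, {g | g * d ∈ A i}
  have hB : ∀ i, IsOpen (B i) := fun i =>
    isOpen_iUnion fun d => (hA i).preimage (continuous_mul_const _)
  -- Since V⁻¹V meets `D` only in 1, each `A i` contains at most one point of a coset gD. `F` takes
  -- that point from the first `A i` meeting the coset; `B i` is the union of the cosets meeting `A
  -- i`.
  set F : Set G := ⋃ i, A i ∩ ⋂ j : Fin i, (B j)ᶜ
  have hF : MeasurableSet F := MeasurableSet.iUnion fun i =>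
    (hA i).measurableSet.inter (MeasurableSet.iInter fun j => (hB j).measurableSet.compl)
  have hBD : ∀ (i : ℕ) (g : G) (d : D), g * d ∈ B i ↔ g ∈ B i := by
    intro i g d
    simp only [B, Set.mem_iUnion, Set.mem_ofPred_eq]
    constructor
    · rintro ⟨e, he⟩
      exact ⟨d * e, by simpa [mul_assoc] using he⟩
    · rintro ⟨e, he⟩
      exact ⟨d⁻¹ * e, by simpa [mul_assoc] using he⟩
  have hcover : ∀ g : G, ∃ i, g ∈ B i := by
    intro g
    obtain ⟨i, hi⟩ := (TopologicalSpace.denseRange_denseSeq G).exists_mem_open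
      (s := {x | x⁻¹ * g ∈ V}) (hVo.preimage (by fun_prop)) ⟨g, by simpa using hV1⟩
    exact ⟨i, Set.mem_iUnion.mpr ⟨1, by simpa [A] using hi⟩⟩
  refine ⟨F.indicator 1, measurable_one.indicator hF, fun g => ?_⟩
  classical
  set i := Nat.find (hcover g) with hi
  have hmin : ∀ j < i, g ∉ B j := fun j hj => Nat.find_min (hcover g) hj
  have hiB : g ∈ B i := Nat.find_spec (hcover g)
  obtain ⟨d, hd⟩ := Set.mem_iUnion.mp hiB
  have hFiff : ∀ e : D, g * e ∈ F ↔ g * e ∈ A i := by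
    intro e
    simp only [F, Set.mem_iUnion, Set.mem_inter_iff, Set.mem_iInter, Set.mem_compl_iff, hBD]
    constructor
    · rintro ⟨j, hj, hj'⟩
      rcases lt_trichotomy j i with h | h | h
      · exact absurd ((hBD j g e).mp (Set.mem_iUnion.mpr ⟨1, by simpa using hj⟩)) (hmin j h)
      · rwa [← h]
      · exact absurd hiB (hj' ⟨i, h⟩)
    · intro h
      exact ⟨i, h, fun j => hmin j j.2⟩
  rw [tsum_eq_single d]
  · rw [Set.indicator_of_mem ((hFiff d).mpr hd)]; rfl
  · intro e he
    refine Set.indicator_of_notMem (fun hmemF => he ?_) _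
    have he' := (hFiff e).mp hmemF
    have : ((d⁻¹ * e : D) : G) ∈ W := by
      have := hV'W (Set.mk_mem_prod (hVV' hd) (hVV' he'))
      simpa [mul_assoc] using this
    have h1 := hWD _ (d⁻¹ * e).2 this
    have h2 : d⁻¹ * e = 1 := Subtype.ext h1
    exact (inv_mul_eq_one.mp h2).symm

theorem isFiniteMeasureOnCompacts_count {X : Type*} [TopologicalSpace X] [DiscreteTopology X]
    [MeasurableSpace X] [MeasurableSingletonClass X] :
    IsFiniteMeasureOnCompacts (Measure.count : Measure X) :=
  ⟨fun _ hs => Measure.count_apply_lt_top.mpr hs.finite_of_discrete⟩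

end Discrete

/-! ### Sums over the orbit gΓ.o -/

section OrbitSum

variable {G : Type*} [Group G]

/-- The sum of `u` over the orbit `gΓ.o`, where `y = gΓ`. -/
def orbitSum (H : Subgroup G) {Γ : Subgroup G} (u : G ⧸ H → ℝ≥0∞) (y : G ⧸ Γ) : ℝ≥0∞ :=
  ∑' x : orbitPoints H y, u x

theorem orbitPoints_smul (H : Subgroup G) {Γ : Subgroup G} (g : G) (y : G ⧸ Γ) :
    orbitPoints H (g • y) = (fun x => g • x) '' orbitPoints H y := by
  ext x
  constructor
  · rintro ⟨a, ha, rfl⟩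
    refine ⟨g⁻¹ • (a : G ⧸ H), ⟨g⁻¹ * a, ?_, rfl⟩, smul_inv_smul _ _⟩
    rw [← inv_smul_eq_iff.mpr ha]
    rfl
  · rintro ⟨_, ⟨a, rfl, rfl⟩, rfl⟩
    exact ⟨g * a, rfl, rfl⟩

theorem orbitSum_smul (H : Subgroup G) {Γ : Subgroup G} (u : G ⧸ H → ℝ≥0∞) (g : G) (y : G ⧸ Γ) :
    orbitSum H u (g • y) = orbitSum H (fun x => u (g • x)) y := by
  rw [orbitSum, orbitPoints_smul, tsum_image u (MulAction.injective g).injOn, orbitSum]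

theorem orbitSum_mono {H Γ : Subgroup G} {u v : G ⧸ H → ℝ≥0∞} (h : ∀ x, u x ≤ v x) (y : G ⧸ Γ) :
    orbitSum H u y ≤ orbitSum H v y :=
  ENNReal.tsum_le_tsum fun x => h x

theorem orbitSum_const_mul {H Γ : Subgroup G} (c : ℝ≥0∞) (u : G ⧸ H → ℝ≥0∞) (y : G ⧸ Γ) :
    orbitSum H (fun x => c * u x) y = c * orbitSum H u y :=
  ENNReal.tsum_mul_left

theorem orbitSum_indicator {H Γ : Subgroup G} (u : G ⧸ H → ℝ≥0∞) (B : Set (G ⧸ H)) (y : G ⧸ Γ) :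
    orbitSum H (B.indicator u) y = ∑' x : ↥(orbitPoints H y ∩ B), u x := by
  rw [orbitSum, tsum_subtype (orbitPoints H y) (B.indicator u), Set.indicator_indicator,
    tsum_subtype]

/-- The points of gΓ.o correspond to Γ/(Γ ∩ H). The weight `b` has total mass 1 on each coset of Γ ∩
H, so it compensates for the repetitions when summing over all of `Γ`. -/
theorem orbitSum_mk {H Γ : Subgroup G} {b : G → ℝ≥0∞}
    (hb : ∀ g : G, ∑' d : ↥(Γ ⊓ H), b (g * d) = 1) (u : G ⧸ H → ℝ≥0∞) (g : G) :
    orbitSum H u (g : G ⧸ Γ) = ∑' c : Γ, u ((g * c : G) : G ⧸ H) * b (g * c) := by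
  set p : Γ → orbitPoints H (g : G ⧸ Γ) := fun c =>
    ⟨((g * c : G) : G ⧸ H), g * c, by rw [QuotientGroup.mk_mul_of_mem _ c.2], rfl⟩
  rw [← ENNReal.tsum_fiberwise _ p, orbitSum]
  refine tsum_congr fun x => ?_
  obtain ⟨x, a, ha, rfl⟩ := x
  obtain ⟨c₀, rfl⟩ : ∃ c₀ : Γ, a = g * c₀ :=
    ⟨⟨g⁻¹ * a, QuotientGroup.eq.mp ha.symm⟩, by simp⟩
  have hfib : ∀ c : Γ, p c = p c₀ ↔ (c₀⁻¹ * c : G) ∈ H := by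
    intro c
    rw [eq_comm, Subtype.ext_iff]
    simp only [p]
    rw [QuotientGroup.eq]
    simp [mul_assoc]
  let e : ↥(Γ ⊓ H) ≃ ↥(p ⁻¹' {p c₀}) :=
    { toFun := fun d => ⟨c₀ * ⟨d, d.2.1⟩, (hfib _).mpr (by simpa using d.2.2)⟩
      invFun := fun c => ⟨(c₀ : G)⁻¹ * (c : Γ), Γ.mul_mem (Γ.inv_mem c₀.2) c.1.2,
        (hfib _).mp c.2⟩
      left_inv := fun d => by ext; simp
      right_inv := fun c => by ext; simp }
  change u ((g * c₀ : G) : G ⧸ H) = ∑' c : ↥(p ⁻¹' {p c₀}), _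
  have hterm : ∀ c : ↥(p ⁻¹' {p c₀}),
      u ((g * (c : Γ) : G) : G ⧸ H) * b (g * (c : Γ)) =
        u ((g * c₀ : G) : G ⧸ H) * b (g * (c : Γ)) := by
    rintro ⟨c, hc⟩
    have : ((g * c : G) : G ⧸ H) = ((g * c₀ : G) : G ⧸ H) := congrArg Subtype.val hc
    rw [this]
  rw [tsum_congr hterm, ENNReal.tsum_mul_left, ← e.tsum_eq]
  have := hb (g * c₀)
  simp only [mul_assoc] at this
  have h2 : ∑' d : ↥(Γ ⊓ H), b (g * ((e d : Γ) : G)) = 1 := this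
  rw [h2, mul_one]

end OrbitSum

/-! ### The unfolding identity -/

section Unfolding

variable {G : Type*} [Group G] [TopologicalSpace G]

theorem discreteTopology_inf (Γ H : Subgroup G) [DiscreteTopology Γ] :
    DiscreteTopology ↥(Γ ⊓ H) :=
  DiscreteTopology.of_continuous_injective (f := fun d : ↥(Γ ⊓ H) => (⟨d, d.2.1⟩ : Γ))
    (by fun_prop) fun a b h => by
      have := congrArg Subtype.val h
      exact Subtype.ext this

theorem discreteTopology_subgroupOf (Γ H : Subgroup G) [DiscreteTopology Γ] :
    DiscreteTopology (Γ.subgroupOf H) :=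
  DiscreteTopology.of_continuous_injective (f := fun d : Γ.subgroupOf H => (⟨d, d.2⟩ : Γ))
    (by fun_prop) fun a b h => by
      have := congrArg Subtype.val h
      exact Subtype.ext (Subtype.ext this)

theorem continuous_orbitMap (H Γ : Subgroup G) : Continuous (orbitMap H Γ) :=
  (QuotientGroup.continuous_mk.comp continuous_subtype_val).quotient_lift _

variable [IsTopologicalGroup G] [SecondCountableTopology G] [MeasurableSpace G] [BorelSpace G]
    {H Γ : Subgroup G} [DiscreteTopology Γ]

/-- The index set of the orbit sum varies with the point. Lifted to `G` and written through
`orbitSum_mk`, it becomes a sum over the fixed countable set `Γ`. -/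
theorem measurable_orbitSum {u : G ⧸ H → ℝ≥0∞} (hu : Measurable u) :
    Measurable (orbitSum H (Γ := Γ) u) := by
  have := discreteTopology_inf Γ H
  obtain ⟨b, hbm, hb⟩ := exists_measurable_tsum_mul_eq_one (Γ ⊓ H)
  have : Countable Γ := countable_of_Lindelof_of_discrete
  rw [QuotientGroup.measurable_from_quotient]
  have : orbitSum H (Γ := Γ) u ∘ (↑) =
      fun g : G => ∑' c : Γ, u ((g * c : G) : G ⧸ H) * b (g * c) :=
    funext fun g => orbitSum_mk hb u g
  rw [this]
  refine Measurable.tsum fun c => ?_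
  have hgc : Measurable fun g : G => g * (c : G) := by fun_prop
  exact ((hu.comp QuotientGroup.measurable_coe).comp hgc).mul (hbm.comp hgc)

variable [T2Space G] [LocallyCompactSpace G]

theorem measurableSMul_quotient (K : Subgroup G) [IsClosed (K : Set G)] :
    MeasurableSMul₂ G (G ⧸ K) := by
  have := borelSpace_quotient K
  exact ⟨continuous_smul.measurable⟩

variable {mG : Measure G} {mH : Measure H} {mGH : Measure (G ⧸ H)} {mGΓ mHΓ : Measure (G ⧸ Γ)}

theorem InvariantMeasures.lintegral_GΓ (hm : InvariantMeasures H Γ mG mH mGH mGΓ mHΓ)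
    {f : G → ℝ≥0∞} (hf : Measurable f) :
    ∫⁻ g, f g ∂mG = ∫⁻ y : G ⧸ Γ, ∑' c : Γ, f (y.out * c) ∂mGΓ := by
  have := hm.haar_G
  have := hm.locallyFinite_GΓ
  have : Countable Γ := countable_of_Lindelof_of_discrete
  have := isFiniteMeasureOnCompacts_count (X := Γ)
  rw [hm.compatible_GΓ.lintegral_eq hf]
  simp_rw [lintegral_count]

theorem InvariantMeasures.isOpenPosMeasure_GΓ (hm : InvariantMeasures H Γ mG mH mGH mGΓ mHΓ) :
    mGΓ.IsOpenPosMeasure := by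
  refine ⟨fun V hV hne h0 => ?_⟩
  have := hm.haar_G
  have := borelSpace_quotient Γ
  have hV' : IsOpen ((↑) ⁻¹' V : Set G) := hV.preimage QuotientGroup.continuous_mk
  refine hV'.measure_ne_zero mG (hne.preimage QuotientGroup.mk_surjective) ?_
  rw [← lintegral_indicator_one hV'.measurableSet,
    hm.lintegral_GΓ (measurable_one.indicator hV'.measurableSet)]
  refine lintegral_eq_zero_of_ae_eq_zero ?_
  filter_upwards [measure_eq_zero_iff_ae_notMem.mp h0] with y hy
  simp only [Pi.zero_apply, ENNReal.tsum_eq_zero]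
  intro c
  refine Set.indicator_of_notMem (fun h => hy ?_) _
  rw [Set.mem_preimage, QuotientGroup.mk_mul_of_mem _ c.2] at h
  convert h
  exact (Quotient.out_eq' y).symm

variable [IsClosed (H : Set G)]

/-- Integrating over `H` by cosets of H ∩ Γ, the factor φ is constant on each coset and `b` sums to
1 there. -/
theorem InvariantMeasures.lintegral_HΓ (hm : InvariantMeasures H Γ mG mH mGH mGΓ mHΓ)
    {b : G → ℝ≥0∞} (hbm : Measurable b) (hb : ∀ g : G, ∑' d : ↥(Γ ⊓ H), b (g * d) = 1)
    {φ : G ⧸ Γ → ℝ≥0∞} (hφ : Measurable φ) (g : G) :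
    ∫⁻ h : H, φ ((g * h : G) : G ⧸ Γ) * b (g * h) ∂mH = ∫⁻ z, φ (g • z) ∂mHΓ := by
  have := hm.haar_H
  have : SecondCountableTopology H := TopologicalSpace.Subtype.secondCountableTopology (H : Set G)
  have := hm.locallyFinite_HΓ
  obtain ⟨ν, hν, rfl⟩ := hm.compatible_HΓ
  have := discreteTopology_subgroupOf Γ H
  have : Countable (Γ.subgroupOf H) := countable_of_Lindelof_of_discrete
  have := isFiniteMeasureOnCompacts_count (X := Γ.subgroupOf H)
  have : LocallyCompactSpace H :=
    (IsClosed.isClosedEmbedding_subtypeVal ‹IsClosed (H : Set G)›).locallyCompactSpace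
  have := borelSpace_quotient Γ
  have := borelSpace_quotient (Γ.subgroupOf H)
  have := measurableSMul_quotient Γ
  have hom : Measurable (orbitMap H Γ) := (continuous_orbitMap H Γ).measurable
  -- Local finiteness is known only for the pushforward of `ν`; it is pulled back along the
  -- continuous orbit map.
  have : IsLocallyFiniteMeasure ν := by
    refine ⟨fun q => ?_⟩
    obtain ⟨s, hs, hsf⟩ := (ν.map (orbitMap H Γ)).finiteAt_nhds (orbitMap H Γ q)
    refine ⟨orbitMap H Γ ⁻¹' s, (continuous_orbitMap H Γ).continuousAt hs, ?_⟩
    exact (Measure.le_map_apply hom.aemeasurable s).trans_lt hsf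
  rw [hν.lintegral_eq (f := fun h : H => φ ((g * h : G) : G ⧸ Γ) * b (g * h)),
    lintegral_map (f := fun z => φ (g • z)) (hφ.comp (measurable_const_smul g)) hom]
  · refine lintegral_congr fun q => ?_
    rw [lintegral_count]
    have h1 : ∀ d : Γ.subgroupOf H,
        φ ((g * ((q.out * (d : H) : H) : G) : G) : G ⧸ Γ) = φ (g • orbitMap H Γ q) := by
      intro d
      congr 1
      conv_rhs => rw [← Quotient.out_eq' q]
      change _ = ((g * (q.out : H) : G) : G ⧸ Γ)
      rw [QuotientGroup.eq]
      have hd := Γ.inv_mem (Subgroup.mem_subgroupOf.mp d.2)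
      simpa [mul_assoc] using hd
    have h2 : ∑' d : Γ.subgroupOf H, b (g * ((q.out * (d : H) : H) : G)) = 1 := by
      let e : ↥(Γ ⊓ H) ≃ Γ.subgroupOf H :=
        { toFun := fun d => ⟨⟨d, d.2.2⟩, d.2.1⟩
          invFun := fun d => ⟨d, d.2, d.1.2⟩
          left_inv := fun d => rfl
          right_inv := fun d => rfl }
      rw [← e.tsum_eq, ← hb (g * (q.out : H))]
      refine tsum_congr fun d => ?_
      simp [e, mul_assoc]
    simp_rw [h1]
    rw [ENNReal.tsum_mul_left, h2, mul_one]
  · have hgh : Measurable fun h : H => g * (h : G) := by fun_prop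
    exact ((hφ.comp QuotientGroup.measurable_coe).comp hgh).mul (hbm.comp hgh)

/-- The unfolding identity. -/
theorem InvariantMeasures.lintegral_mul_orbitSum (hm : InvariantMeasures H Γ mG mH mGH mGΓ mHΓ)
    {φ : G ⧸ Γ → ℝ≥0∞} (hφ : Measurable φ) {u : G ⧸ H → ℝ≥0∞} (hu : Measurable u) :
    ∫⁻ y, φ y * orbitSum H u y ∂mGΓ =
      ∫⁻ x, u x * ∫⁻ z, φ (x.out • z) ∂mHΓ ∂mGH := by
  have := discreteTopology_inf Γ H
  obtain ⟨b, hbm, hb⟩ := exists_measurable_tsum_mul_eq_one (Γ ⊓ H)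
  have := hm.haar_G
  have := hm.haar_H
  have : SecondCountableTopology H := TopologicalSpace.Subtype.secondCountableTopology (H : Set G)
  have : LocallyCompactSpace H :=
    (IsClosed.isClosedEmbedding_subtypeVal ‹IsClosed (H : Set G)›).locallyCompactSpace
  have := hm.locallyFinite_GH
  -- Both sides are the integral of this `f` over `G`, disintegrated along `Γ` for the left side and
  -- along `H` for the right side.
  set f : G → ℝ≥0∞ := fun g => φ (g : G ⧸ Γ) * (u (g : G ⧸ H) * b g) with hf
  have hfm : Measurable f := (hφ.comp QuotientGroup.measurable_coe).mul
    ((hu.comp QuotientGroup.measurable_coe).mul hbm)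
  have h1 : ∫⁻ g, f g ∂mG = ∫⁻ y, φ y * orbitSum H u y ∂mGΓ := by
    rw [hm.lintegral_GΓ hfm]
    refine lintegral_congr fun y => ?_
    conv_rhs => rw [← Quotient.out_eq' y]
    change _ = φ ((y.out : G) : G ⧸ Γ) * orbitSum H u ((y.out : G) : G ⧸ Γ)
    rw [orbitSum_mk hb, ← ENNReal.tsum_mul_left]
    refine tsum_congr fun c => ?_
    simp only [hf]
    rw [QuotientGroup.mk_mul_of_mem _ c.2]
  rw [← h1, hm.compatible_GH.lintegral_eq hfm]
  refine lintegral_congr fun x => ?_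
  rw [← hm.lintegral_HΓ hbm hb hφ, ← lintegral_const_mul]
  · refine lintegral_congr fun h => ?_
    simp only [hf]
    have : ((x.out * (h : G) : G) : G ⧸ H) = x := by
      rw [QuotientGroup.mk_mul_of_mem _ h.2]
      exact Quotient.out_eq' x
    rw [this]
    ring
  · have hgh : Measurable fun h : H => x.out * (h : G) := by fun_prop
    exact ((hφ.comp QuotientGroup.measurable_coe).comp hgh).mul (hbm.comp hgh)

/-- The integral of a test function against the averaged translates of `m_[H]`. -/
theorem InvariantMeasures.lintegral_averagedTranslates
    (hm : InvariantMeasures H Γ mG mH mGH mGΓ mHΓ) {l w : G ⧸ H → ℝ} (hl : Continuous l)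
    (hw : Continuous w) {C : ℝ → ℝ} {R : ℝ} (hC : 0 < C R)
    {φ : G ⧸ Γ → ℝ≥0∞} (hφ : Measurable φ) :
    ∫⁻ y, φ y * (orbitSum H ((heightBall l R).indicator fun x => ENNReal.ofReal (w x)) y /
      ENNReal.ofReal (C R)) ∂mGΓ = ∫⁻ y, φ y ∂(averagedTranslates mGH mHΓ l w C R) := by
  have := borelSpace_quotient Γ
  have := borelSpace_quotient H
  have := measurableSMul_quotient Γ
  have := hm.locallyFinite_HΓ
  have hB : MeasurableSet (heightBall l R) := (isClosed_le hl continuous_const).measurableSet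
  have hwm : Measurable fun x => ENNReal.ofReal (w x) := hw.measurable.ennreal_ofReal
  have hu := hwm.indicator hB
  have hmeas : Measurable fun x : G ⧸ H =>
      ENNReal.ofReal (w x) • mHΓ.map (fun y => x.out • y) := by
    have h0 := measurable_map_out_smul hm.invariant_HΓ
    refine Measure.measurable_of_measurable_coe _ fun s hs => ?_
    simp only [Measure.smul_apply, smul_eq_mul]
    exact hwm.mul ((Measure.measurable_coe hs).comp h0)
  have e1 : ∀ y, φ y * (orbitSum H ((heightBall l R).indicator fun x => ENNReal.ofReal (w x)) y /
      ENNReal.ofReal (C R)) = (ENNReal.ofReal (C R))⁻¹ *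
        (φ y * orbitSum H ((heightBall l R).indicator fun x => ENNReal.ofReal (w x)) y) := by
    intro y
    rw [div_eq_mul_inv]
    ring
  simp_rw [e1]
  rw [lintegral_const_mul _ (by exact hφ.mul (measurable_orbitSum hu)), hm.lintegral_mul_orbitSum hφ hu,
    averagedTranslates, lintegral_smul_measure,
    Measure.lintegral_bind hmeas.aemeasurable hφ.aemeasurable, one_div,
    ENNReal.ofReal_inv_of_pos hC, ← lintegral_indicator hB, smul_eq_mul]
  congr 1
  refine lintegral_congr fun x => ?_
  by_cases hx : x ∈ heightBall l R
  · simp only [Set.indicator_of_mem hx]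
    rw [lintegral_smul_measure, lintegral_map hφ (measurable_const_smul _), smul_eq_mul]
  · simp [Set.indicator_of_notMem hx]

end Unfolding

/-! ### From weak-* to pointwise convergence for slowly varying families -/

section Limits

variable {X : Type*} [TopologicalSpace X]

/-- The family `N R` varies slowly near each point, up to a rescaling of the parameter `R`. -/
def IsSlowlyVaryingFamily (N : ℝ → X → ℝ≥0∞) : Prop :=
  ∀ K : ℝ, 1 < K → ∀ y : X, ∃ a : ℝ, 0 < a ∧ ∃ V ∈ 𝓝 y, ∀ᶠ R in atTop, ∀ z ∈ V,
    N R z ≤ ENNReal.ofReal K * N (a * R) y ∧ N R y ≤ ENNReal.ofReal K * N (a * R) z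

variable {N : ℝ → X → ℝ≥0∞} {U : Set X}

/-- Along R and along aR the family has the same limit, so the rescaling disappears and only the
factor `K` remains. -/
theorem IsSlowlyVaryingFamily.limit_le (hN : IsSlowlyVaryingFamily N) {f : X → ℝ≥0∞}
    (hf : ∀ y ∈ U, Tendsto (fun R => N R y) atTop (𝓝 (f y))) {K : ℝ} (hK : 1 < K) {y : X}
    (hy : y ∈ U) :
    ∃ V ∈ 𝓝 y, ∀ z ∈ V, z ∈ U → f z ≤ ENNReal.ofReal K * f y ∧ f y ≤ ENNReal.ofReal K * f z := by
  obtain ⟨a, ha, V, hV, h⟩ := hN K hK y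
  have hta : Tendsto (fun R : ℝ => a * R) atTop atTop := tendsto_id.const_mul_atTop ha
  refine ⟨V, hV, fun z hz hzU => ⟨?_, ?_⟩⟩
  · exact le_of_tendsto_of_tendsto (hf z hzU)
      (ENNReal.Tendsto.const_mul ((hf y hy).comp hta) (Or.inr ENNReal.ofReal_ne_top))
      (h.mono fun R hR => (hR z hz).1)
  · exact le_of_tendsto_of_tendsto (hf y hy)
      (ENNReal.Tendsto.const_mul ((hf z hzU).comp hta) (Or.inr ENNReal.ofReal_ne_top))
      (h.mono fun R hR => (hR z hz).2)

theorem IsSlowlyVaryingFamily.real_limit_le (hN : IsSlowlyVaryingFamily N) {f : X → ℝ}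
    (hf0 : ∀ y, 0 ≤ f y)
    (hf : ∀ y ∈ U, Tendsto (fun R => N R y) atTop (𝓝 (ENNReal.ofReal (f y)))) {K : ℝ}
    (hK : 1 < K) {y : X} (hy : y ∈ U) :
    ∃ V ∈ 𝓝 y, ∀ z ∈ V, z ∈ U → f z ≤ K * f y ∧ f y ≤ K * f z := by
  obtain ⟨V, hV, h⟩ := hN.limit_le hf hK hy
  have hK0 : 0 ≤ K := by linarith
  refine ⟨V, hV, fun z hz hzU => ?_⟩
  have := h z hz hzU
  rwa [← ENNReal.ofReal_mul hK0, ← ENNReal.ofReal_mul hK0,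
    ENNReal.ofReal_le_ofReal_iff (mul_nonneg hK0 (hf0 _)),
    ENNReal.ofReal_le_ofReal_iff (mul_nonneg hK0 (hf0 _))] at this

theorem IsSlowlyVaryingFamily.continuousOn_limit (hN : IsSlowlyVaryingFamily N) {f : X → ℝ}
    (hf0 : ∀ y, 0 ≤ f y)
    (hf : ∀ y ∈ U, Tendsto (fun R => N R y) atTop (𝓝 (ENNReal.ofReal (f y)))) :
    ContinuousOn f U := by
  intro y hy
  refine Metric.continuousWithinAt_iff'.mpr fun δ hδ => ?_
  have hy0 := hf0 y
  -- The choice makes `t * f y < δ`; the summand 1 covers the case `f y = 0`.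
  set t : ℝ := δ / (f y + 1) with ht
  have ht0 : 0 < t := by positivity
  obtain ⟨V, hV, h⟩ := hN.real_limit_le hf0 hf (show 1 < 1 + t by linarith) hy
  filter_upwards [mem_nhdsWithin_of_mem_nhds hV, self_mem_nhdsWithin] with z hz hzU
  obtain ⟨h1, h2⟩ := h z hz hzU
  have htf : t * f y < δ := by
    rw [ht, div_mul_eq_mul_div, div_lt_iff₀ (by positivity)]
    nlinarith
  rw [Real.dist_eq, abs_lt]
  constructor
  · by_contra! hc
    have : f z < f y := by linarith
    nlinarith
  · nlinarith

/-- Near each point the family is eventually at most twice its value there at the rescaled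
parameter; finitely many such neighbourhoods cover `S`. This provides the dominating function for
the limit of integrals. -/
theorem IsSlowlyVaryingFamily.eventually_le_of_isCompact (hN : IsSlowlyVaryingFamily N)
    {f : X → ℝ≥0∞} (hf : ∀ y ∈ U, Tendsto (fun R => N R y) atTop (𝓝 (f y)))
    (hftop : ∀ y ∈ U, f y ≠ ∞) {S : Set X} (hS : IsCompact S) (hSU : S ⊆ U) :
    ∃ M : ℝ≥0∞, M ≠ ∞ ∧ ∀ᶠ R in atTop, ∀ z ∈ S, N R z ≤ M := by
  refine hS.induction_on (p := fun S => ∃ M : ℝ≥0∞, M ≠ ∞ ∧ ∀ᶠ R in atTop, ∀ z ∈ S, N R z ≤ M)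
    ⟨0, by simp, by simp⟩ ?_ ?_ ?_
  · rintro s t hst ⟨M, hM, h⟩
    exact ⟨M, hM, h.mono fun R hR z hz => hR z (hst hz)⟩
  · rintro s t ⟨M, hM, h⟩ ⟨M', hM', h'⟩
    refine ⟨max M M', (max_lt hM.lt_top hM'.lt_top).ne, ?_⟩
    filter_upwards [h, h'] with R hR hR' z hz
    rcases hz with hz | hz
    · exact (hR z hz).trans (le_max_left _ _)
    · exact (hR' z hz).trans (le_max_right _ _)
  · intro y hy
    obtain ⟨a, ha, V, hV, h⟩ := hN 2 (by norm_num) y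
    have hta : Tendsto (fun R : ℝ => a * R) atTop atTop := tendsto_id.const_mul_atTop ha
    have hlt : f y < f y + 1 := ENNReal.lt_add_right (hftop y (hSU hy)) one_ne_zero
    refine ⟨V, mem_nhdsWithin_of_mem_nhds hV, ENNReal.ofReal 2 * (f y + 1), ?_, ?_⟩
    · exact ENNReal.mul_ne_top ENNReal.ofReal_ne_top
        (ENNReal.add_ne_top.mpr ⟨hftop y (hSU hy), ENNReal.one_ne_top⟩)
    · filter_upwards [h, hta.eventually ((hf y (hSU hy)).eventually_lt_const hlt)] with R hR hR' z hz
      exact (hR z hz).1.trans (by gcongr)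

variable [MeasurableSpace X]

/-- Weak-* convergence of the measures `N R • m` towards `μ` over `U`. -/
def LIntegralTendstoOn (U : Set X) (m : Measure X) (N : ℝ → X → ℝ≥0∞) (μ : Measure X) : Prop :=
  ∀ φ : X → ℝ, Continuous φ → HasCompactSupport φ → tsupport φ ⊆ U → (∀ x, 0 ≤ φ x) →
    Tendsto (fun R => ∫⁻ y, ENNReal.ofReal (φ y) * N R y ∂m) atTop
      (𝓝 (∫⁻ y, ENNReal.ofReal (φ y) ∂μ))

variable [BorelSpace X]

theorem lintegral_ofReal_lt_top {m : Measure X} [IsFiniteMeasureOnCompacts m] {φ : X → ℝ}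
    (hφ : Continuous φ) (hφc : HasCompactSupport φ) : ∫⁻ y, ENNReal.ofReal (φ y) ∂m < ∞ :=
  (hφ.integrable_of_hasCompactSupport hφc).lintegral_lt_top

variable {m μ : Measure X} [IsFiniteMeasureOnCompacts m]

theorem IsSlowlyVaryingFamily.lintegral_eq (hN : IsSlowlyVaryingFamily N)
    (hNm : ∀ R, Measurable (N R)) (hNμ : LIntegralTendstoOn U m N μ) {f : X → ℝ}
    (hf : ∀ y ∈ U, Tendsto (fun R => N R y) atTop (𝓝 (ENNReal.ofReal (f y)))) {φ : X → ℝ}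
    (hφ : Continuous φ) (hφc : HasCompactSupport φ) (hφU : tsupport φ ⊆ U) (hφ0 : ∀ x, 0 ≤ φ x) :
    ∫⁻ y, ENNReal.ofReal (φ y) ∂μ = ∫⁻ y, ENNReal.ofReal (φ y) * ENNReal.ofReal (f y) ∂m := by
  obtain ⟨M, hM, hle⟩ := hN.eventually_le_of_isCompact hf (fun _ _ => ENNReal.ofReal_ne_top) hφc hφU
  have hφm : Measurable fun y => ENNReal.ofReal (φ y) := hφ.measurable.ennreal_ofReal
  have hzero : ∀ z, z ∉ tsupport φ → ENNReal.ofReal (φ z) = 0 := fun z hz => by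
    rw [image_eq_zero_of_notMem_tsupport hz, ENNReal.ofReal_zero]
  refine tendsto_nhds_unique (hNμ φ hφ hφc hφU hφ0)
    (tendsto_lintegral_filter_of_dominated_convergence (fun y => ENNReal.ofReal (φ y) * M)
      (Eventually.of_forall fun R => hφm.mul (hNm R)) ?_ ?_ ?_)
  · filter_upwards [hle] with R hR
    filter_upwards with z
    by_cases hz : z ∈ tsupport φ
    · gcongr
      exact hR z hz
    · simp [hzero z hz]
  · rw [lintegral_mul_const _ hφm]
    exact ENNReal.mul_ne_top (lintegral_ofReal_lt_top hφ hφc).ne hM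
  · filter_upwards with z
    by_cases hz : z ∈ tsupport φ
    · exact ENNReal.Tendsto.const_mul (hf z (hφU hz)) (Or.inr ENNReal.ofReal_ne_top)
    · simp [hzero z hz]

variable [T2Space X] [LocallyCompactSpace X]

theorem exists_testFunction (m : Measure X) [m.IsOpenPosMeasure] {V : Set X} {y : X}
    (hV : V ∈ 𝓝 y) :
    ∃ φ : X → ℝ, Continuous φ ∧ HasCompactSupport φ ∧ tsupport φ ⊆ V ∧ (∀ x, 0 ≤ φ x) ∧
      ∫⁻ y, ENNReal.ofReal (φ y) ∂m ≠ 0 := by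
  obtain ⟨W, hWV, hW, hyW⟩ := mem_nhds_iff.mp hV
  obtain ⟨φ, h1, hc, hs, hI⟩ := exists_continuousMap_one_of_isCompact_subset_isOpen
    (isCompact_singleton (x := y)) hW (by simpa using hyW)
  refine ⟨φ, map_continuous φ, hc, hs.trans hWV, fun x => (hI x).1, ?_⟩
  have hφy : φ y = 1 := h1 rfl
  have hcont : Continuous fun x => ENNReal.ofReal (φ x) :=
    ENNReal.continuous_ofReal.comp (map_continuous φ)
  intro h0
  have hae := (lintegral_eq_zero_iff hcont.measurable).mp h0
  have := congrFun ((hcont.ae_eq_iff_eq m continuous_const).mp hae) y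
  simp [hφy] at this

variable [m.IsOpenPosMeasure] [IsFiniteMeasureOnCompacts μ]

/-- Both quantities are compared with the ratio `q / p` of the masses of a bump function near `y`
under `μ` and `m`, at the cost of one factor `K` each. -/
theorem IsSlowlyVaryingFamily.limsup_le_liminf (hN : IsSlowlyVaryingFamily N)
    (hNμ : LIntegralTendstoOn U m N μ) (hU : IsOpen U) {y : X} (hy : y ∈ U) {K : ℝ} (hK : 1 < K) :
    limsup (fun R => N R y) atTop < ∞ ∧
      limsup (fun R => N R y) atTop ≤
        ENNReal.ofReal K * (ENNReal.ofReal K * liminf (fun R => N R y) atTop) := by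
  obtain ⟨a, ha, V, hV, h⟩ := hN K hK y
  have hta : Tendsto (fun R : ℝ => a * R) atTop atTop := tendsto_id.const_mul_atTop ha
  have hta' : Tendsto (fun R : ℝ => a⁻¹ * R) atTop atTop :=
    tendsto_id.const_mul_atTop (inv_pos.mpr ha)
  obtain ⟨φ, hφ, hφc, hφV, hφ0, hp0⟩ := exists_testFunction m (inter_mem hV (hU.mem_nhds hy))
  have hφm : Measurable fun y => ENNReal.ofReal (φ y) := hφ.measurable.ennreal_ofReal
  have hzero : ∀ z, z ∉ V → ENNReal.ofReal (φ z) = 0 := fun z hz => by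
    rw [image_eq_zero_of_notMem_tsupport fun h' => hz (hφV h').1, ENNReal.ofReal_zero]
  have hconv := hNμ φ hφ hφc (hφV.trans Set.inter_subset_right) hφ0
  have hptop := (lintegral_ofReal_lt_top (m := m) hφ hφc).ne
  have hqtop := (lintegral_ofReal_lt_top (m := μ) hφ hφc).ne
  set p := ∫⁻ y, ENNReal.ofReal (φ y) ∂m
  set q := ∫⁻ y, ENNReal.ofReal (φ y) ∂μ
  set k := ENNReal.ofReal K
  have hk0 : k ≠ 0 := by simp [k]; linarith
  have hktop : k ≠ ∞ := ENNReal.ofReal_ne_top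
  have hup : limsup (fun R => N R y) atTop ≤ k * q / p := by
    have hlim : Tendsto (fun R => k * (∫⁻ z, ENNReal.ofReal (φ z) * N (a * R) z ∂m) / p) atTop
        (𝓝 (k * q / p)) :=
      ENNReal.Tendsto.div_const (ENNReal.Tendsto.const_mul (hconv.comp hta) (Or.inr hktop))
        (Or.inr hp0)
    rw [← hlim.limsup_eq]
    refine limsup_le_limsup ?_
    filter_upwards [h] with R hR
    rw [ENNReal.le_div_iff_mul_le (Or.inl hp0) (Or.inl hptop), mul_comm,
      ← lintegral_mul_const _ hφm, ← lintegral_const_mul' _ _ hktop]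
    refine lintegral_mono fun z => ?_
    by_cases hz : z ∈ V
    · calc ENNReal.ofReal (φ z) * N R y ≤ ENNReal.ofReal (φ z) * (k * N (a * R) z) := by
            gcongr
            exact (hR z hz).2
        _ = _ := by ring
    · simp [hzero z hz]
  -- The slow variation bound is used at the parameter a⁻¹R, so that its majorant is `N R y` itself.
  have hlow : q / p ≤ k * liminf (fun R => N R y) atTop := by
    have hlim : Tendsto (fun R => (∫⁻ z, ENNReal.ofReal (φ z) * N (a⁻¹ * R) z ∂m) / p / k) atTop
        (𝓝 (q / p / k)) :=
      ENNReal.Tendsto.div_const (ENNReal.Tendsto.div_const (hconv.comp hta') (Or.inr hp0))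
        (Or.inr hk0)
    rw [← ENNReal.div_le_iff' hk0 hktop, ← hlim.liminf_eq]
    refine liminf_le_liminf ?_
    filter_upwards [hta'.eventually h] with R hR
    rw [ENNReal.div_le_iff' hk0 hktop, ENNReal.div_le_iff hp0 hptop, mul_comm _ p,
      ← lintegral_mul_const _ hφm]
    refine lintegral_mono fun z => ?_
    by_cases hz : z ∈ V
    · have := (hR z hz).1
      rw [mul_inv_cancel_left₀ ha.ne'] at this
      gcongr
    · simp [hzero z hz]
  refine ⟨hup.trans_lt (ENNReal.div_lt_top (ENNReal.mul_ne_top hktop hqtop) hp0), hup.trans ?_⟩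
  rw [mul_div_assoc]
  gcongr

/-- The case K = 2 gives a finite limsup; letting K → 1 then closes the gap to the liminf. -/
theorem IsSlowlyVaryingFamily.exists_tendsto (hN : IsSlowlyVaryingFamily N)
    (hNμ : LIntegralTendstoOn U m N μ) (hU : IsOpen U) {y : X} (hy : y ∈ U) :
    ∃ c : ℝ, 0 ≤ c ∧ Tendsto (fun R => N R y) atTop (𝓝 (ENNReal.ofReal c)) := by
  have htop := (hN.limsup_le_liminf hNμ hU hy one_lt_two).1.ne
  refine ⟨(limsup (fun R => N R y) atTop).toReal, ENNReal.toReal_nonneg, ?_⟩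
  rw [ENNReal.ofReal_toReal htop]
  refine tendsto_of_le_liminf_of_limsup_le ?_ le_rfl
  set i := liminf (fun R => N R y) atTop
  have hlim : Tendsto (fun K : ℝ => ENNReal.ofReal K * (ENNReal.ofReal K * i)) (𝓝[>] 1)
      (𝓝 (ENNReal.ofReal 1 * (ENNReal.ofReal 1 * i))) := by
    have h1 : Tendsto (fun K : ℝ => ENNReal.ofReal K) (𝓝[>] 1) (𝓝 (ENNReal.ofReal 1)) :=
      (ENNReal.continuous_ofReal.tendsto 1).mono_left nhdsWithin_le_nhds
    have hi : i ≠ ∞ := ((liminf_le_limsup).trans_lt htop.lt_top).ne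
    refine ENNReal.Tendsto.mul h1 (Or.inl (by simp)) ?_ (Or.inr (by simp))
    exact ENNReal.Tendsto.mul_const h1 (Or.inr hi)
  simp only [ENNReal.ofReal_one, one_mul] at hlim
  refine ge_of_tendsto hlim ?_
  filter_upwards [self_mem_nhdsWithin] with K hK
  exact (hN.limsup_le_liminf hNμ hU hy hK).2

variable [SecondCountableTopology X]

/-- With a cutoff ψ equal to 1 on a compact S ⊆ U, the products of ψ with bounded continuous
functions are admissible tests. They determine the finite measure ψμ, hence μ on `S`; countably many
such `S` exhaust `U`. -/
theorem restrict_eq_withDensity {m : Measure X} {f : X → ℝ} (hU : IsOpen U) (hfc : ContinuousOn f U)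
    (h : ∀ φ : X → ℝ, Continuous φ → HasCompactSupport φ → tsupport φ ⊆ U → (∀ x, 0 ≤ φ x) →
      ∫⁻ y, ENNReal.ofReal (φ y) ∂μ = ∫⁻ y, ENNReal.ofReal (φ y) * ENNReal.ofReal (f y) ∂m) :
    μ.restrict U = (m.restrict U).withDensity (fun y => ENNReal.ofReal (f y)) := by
  set ν := (m.restrict U).withDensity (fun y => ENNReal.ofReal (f y)) with hν
  have hfm : AEMeasurable (fun y => ENNReal.ofReal (f y)) (m.restrict U) :=
    (hfc.aemeasurable hU.measurableSet).ennreal_ofReal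
  have hνU : ν.restrict U = ν := by
    rw [hν, restrict_withDensity hU.measurableSet, Measure.restrict_restrict hU.measurableSet,
      Set.inter_self]
  have hcompact : ∀ S : Set X, IsCompact S → S ⊆ U → μ.restrict S = ν.restrict S := by
    intro S hS hSU
    obtain ⟨ψ, hψ1, hψc, hψU, hψI⟩ := exists_continuousMap_one_of_isCompact_subset_isOpen hS hU hSU
    have hψm : Measurable fun y => ENNReal.ofReal (ψ y) :=
      (map_continuous ψ).measurable.ennreal_ofReal
    have hfin : IsFiniteMeasure (μ.withDensity fun y => ENNReal.ofReal (ψ y)) :=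
      isFiniteMeasure_withDensity (lintegral_ofReal_lt_top (map_continuous ψ) hψc).ne
    have heq : (μ.withDensity fun y => ENNReal.ofReal (ψ y)) =
        ν.withDensity fun y => ENNReal.ofReal (ψ y) := by
      refine ext_of_forall_lintegral_eq_of_IsFiniteMeasure fun η => ?_
      have hηm : Measurable fun y => (η y : ℝ≥0∞) := η.continuous.measurable.coe_nnreal_ennreal
      have hprod : ∀ y, ENNReal.ofReal (ψ y) * (η y : ℝ≥0∞) = ENNReal.ofReal (ψ y * η y) := by
        intro y
        rw [ENNReal.ofReal_mul (hψI y).1, ENNReal.ofReal_coe_nnreal]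
      have hsupp : tsupport (fun y => ψ y * (η y : ℝ)) ⊆ tsupport ψ := tsupport_mul_subset_left
      rw [lintegral_withDensity_eq_lintegral_mul _ hψm hηm,
        lintegral_withDensity_eq_lintegral_mul _ hψm hηm]
      simp only [Pi.mul_apply, hprod]
      rw [h (fun y => ψ y * (η y : ℝ)) (by fun_prop) (HasCompactSupport.mul_right hψc)
        (hsupp.trans hψU) (fun y => mul_nonneg (hψI y).1 (by positivity)), hν,
        lintegral_withDensity_eq_lintegral_mul₀ hfm, ← lintegral_indicator hU.measurableSet]
      · refine lintegral_congr fun y => ?_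
        by_cases hy : y ∈ U
        · rw [Set.indicator_of_mem hy]
          exact mul_comm _ _
        · rw [Set.indicator_of_notMem hy,
            image_eq_zero_of_notMem_tsupport fun h' => hy (hψU h')]
          simp
      · exact (by fun_prop : Continuous fun y => ψ y * (η y : ℝ)).measurable.ennreal_ofReal.aemeasurable
    have hone : ∀ ρ : Measure X,
        (ρ.withDensity fun y => ENNReal.ofReal (ψ y)).restrict S = ρ.restrict S := by
      intro ρ
      rw [restrict_withDensity hS.measurableSet]
      conv_rhs => rw [← withDensity_one (μ := ρ.restrict S)]
      refine withDensity_congr_ae ?_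
      filter_upwards [ae_restrict_mem hS.measurableSet] with y hy
      simp [hψ1 hy]
    rw [← hone μ, heq, hone ν]
  have : LocallyCompactSpace U := hU.locallyCompactSpace
  obtain ⟨S, hS, hSU⟩ := (isSigmaCompact_iff_sigmaCompactSpace (s := U)).mpr inferInstance
  rw [← hνU]
  conv_lhs => rw [← hSU]
  conv_rhs => rw [← hSU]
  exact Measure.restrict_iUnion_congr.mpr fun n =>
    hcompact _ (hS n) (hSU ▸ Set.subset_iUnion S n)

/-- A slowly varying family whose associated measures converge weak-* on `U` converges pointwise
on `U`, and the limit is a continuous density of the limit measure. -/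
theorem IsSlowlyVaryingFamily.exists_density (hN : IsSlowlyVaryingFamily N)
    (hNm : ∀ R, Measurable (N R)) (hNμ : LIntegralTendstoOn U m N μ) (hU : IsOpen U) :
    ∃ f : X → ℝ, ContinuousOn f U ∧ (∀ y, 0 ≤ f y) ∧
      μ.restrict U = (m.restrict U).withDensity (fun y => ENNReal.ofReal (f y)) ∧
      ∀ y ∈ U, Tendsto (fun R => N R y) atTop (𝓝 (ENNReal.ofReal (f y))) := by
  have hex : ∀ y, ∃ c : ℝ, 0 ≤ c ∧
      (y ∈ U → Tendsto (fun R => N R y) atTop (𝓝 (ENNReal.ofReal c))) := by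
    intro y
    by_cases hy : y ∈ U
    · obtain ⟨c, hc, h⟩ := hN.exists_tendsto hNμ hU hy
      exact ⟨c, hc, fun _ => h⟩
    · exact ⟨0, le_rfl, fun h => absurd h hy⟩
  choose f hf0 hf using hex
  have hfc := hN.continuousOn_limit hf0 hf
  exact ⟨f, hfc, hf0, restrict_eq_withDensity hU hfc fun φ hφ hφc hφU hφ0 =>
    hN.lintegral_eq hNm hNμ hf hφ hφc hφU hφ0, hf⟩

/-- Near a zero y of `f` one has f(z) ≤ 2 f(y) = 0, so the zero set is open as well as closed. -/
theorem IsSlowlyVaryingFamily.pos_of_connected {X : Type*} [TopologicalSpace X] [ConnectedSpace X]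
    {N : ℝ → X → ℝ≥0∞} (hN : IsSlowlyVaryingFamily N) {f : X → ℝ} (hfc : Continuous f)
    (hf0 : ∀ y, 0 ≤ f y) (hf : ∀ y, Tendsto (fun R => N R y) atTop (𝓝 (ENNReal.ofReal (f y))))
    {x : X} (hx : f x ≠ 0) (y : X) : 0 < f y := by
  have hclopen : IsClopen {y | f y = 0} := by
    refine ⟨isClosed_eq hfc continuous_const, isOpen_iff_mem_nhds.mpr fun y hy => ?_⟩
    obtain ⟨V, hV, h⟩ := hN.real_limit_le (U := Set.univ) hf0 (fun y _ => hf y) one_lt_two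
      (Set.mem_univ y)
    refine mem_of_superset hV fun z hz => le_antisymm ?_ (hf0 z)
    have h1 := (h z hz trivial).1
    have h2 : f y = 0 := hy
    rwa [h2, mul_zero] at h1
  rcases isClopen_iff.mp hclopen with h | h
  · exact (hf0 y).lt_of_ne' fun h0 => by
      have : y ∈ {y | f y = 0} := h0
      rw [h] at this
      exact this
  · have : x ∈ {y | f y = 0} := h ▸ Set.mem_univ x
    exact absurd this hx

end Limits

/-! ### Growth of the normalizing constants -/

theorem HasPolynomialAsymptotic.tendsto_ratio {C : ℝ → ℝ} (hC : HasPolynomialAsymptotic C) :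
    ∃ c : ℝ, ∀ a : ℝ, 0 < a → Tendsto (fun R => C (a * R) / C R) atTop (𝓝 (a ^ c)) := by
  obtain ⟨hpos, c₁, c₂, c₃, hc₁, -, -, hlim⟩ := hC
  refine ⟨c₂, fun a ha => ?_⟩
  have hta : Tendsto (fun R : ℝ => a * R) atTop atTop := tendsto_id.const_mul_atTop ha
  -- Rescaling R does not affect the logarithmic factor in the limit, so only the power `a ^ c₂`
  -- survives.
  have hlog : Tendsto (fun R : ℝ => Real.log (a * R) / Real.log R) atTop (𝓝 1) := by
    have h1 : Tendsto (fun R : ℝ => Real.log a / Real.log R + 1) atTop (𝓝 (0 + 1)) :=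
      (Real.tendsto_log_atTop.const_div_atTop _).add_const _
    rw [zero_add] at h1
    refine h1.congr' ?_
    filter_upwards [eventually_gt_atTop 1] with R hR
    have : 0 < Real.log R := Real.log_pos hR
    rw [Real.log_mul ha.ne' (by positivity)]
    field_simp
  have hg : Tendsto (fun R : ℝ => a ^ c₂ * (Real.log (a * R) / Real.log R) ^ c₃) atTop
      (𝓝 (a ^ c₂ * 1)) := by
    refine Tendsto.const_mul _ ?_
    simpa using hlog.rpow_const (p := c₃) (Or.inl one_ne_zero)
  have hall := ((hlim.comp hta).inv₀ one_ne_zero).mul (hg.mul hlim)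
  simp only [mul_one, inv_one, one_mul] at hall
  refine hall.congr' ?_
  filter_upwards [eventually_gt_atTop 1, hta.eventually (eventually_gt_atTop 1)] with R hR hR'
  have h1 : 0 < Real.log R := Real.log_pos hR
  have h2 : 0 < Real.log (a * R) := Real.log_pos hR'
  have h3 := hpos R hR.le
  have h4 := hpos (a * R) hR'.le
  have h5 : 0 < Real.log R ^ c₃ := Real.rpow_pos_of_pos h1 _
  have h6 : 0 < Real.log (a * R) ^ c₃ := Real.rpow_pos_of_pos h2 _
  have h7 : 0 < R ^ c₂ := Real.rpow_pos_of_pos (by linarith) _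
  have h8 : 0 < a ^ c₂ := Real.rpow_pos_of_pos ha _
  simp only [Function.comp_apply]
  rw [Real.div_rpow h2.le h1.le, Real.mul_rpow ha.le (by linarith)]
  field_simp

/-- One factor 1+ε will pay for the change of weight, the ratio of constants for the change of
radius; in the limit they cost (1+ε)(1+ε)^c, which tends to 1 as ε → 0. -/
theorem HasPolynomialAsymptotic.exists_ratio_le {C : ℝ → ℝ} (hC : HasPolynomialAsymptotic C)
    {K : ℝ} (hK : 1 < K) :
    ∃ ε : ℝ, 0 < ε ∧ ε < 1 ∧ ∀ᶠ R in atTop, (1 + ε) * C ((1 + ε) * R) ≤ K * C R := by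
  obtain ⟨c, hc⟩ := hC.tendsto_ratio
  have hcont : Tendsto (fun ε : ℝ => (1 + ε) * (1 + ε) ^ c) (𝓝[>] 0) (𝓝 1) := by
    have h1 : ContinuousAt (fun ε : ℝ => (1 + ε) * (1 + ε) ^ c) 0 := by
      refine ContinuousAt.mul (by fun_prop) (ContinuousAt.rpow_const (by fun_prop) (by simp))
    have := h1.tendsto.mono_left (nhdsWithin_le_nhds (s := Set.Ioi 0))
    simpa using this
  obtain ⟨ε, hεK, hε0, hε1⟩ := ((hcont.eventually_lt_const hK).and
    (Ioo_mem_nhdsGT (zero_lt_one' ℝ))).exists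
  refine ⟨ε, hε0, hε1, ?_⟩
  have := (hc (1 + ε) (by linarith)).const_mul (1 + ε)
  filter_upwards [this.eventually_lt_const hεK, eventually_ge_atTop 1] with R hR hR1
  have hpos := hC.1 R hR1
  rw [← mul_div_assoc, div_lt_iff₀ hpos] at hR
  exact hR.le

/-! ### Orbit counts in `[0, ∞]` and in the reals -/

section Counting

variable {G : Type*} [Group G]

/-- The weighted indicator function of `B_R`. -/
def ballWeight {H : Subgroup G} (l w : G ⧸ H → ℝ) (R : ℝ) : G ⧸ H → ℝ≥0∞ :=
  (heightBall l R).indicator fun x => ENNReal.ofReal (w x)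

/-- The normalized weighted orbit count, with values in `[0, ∞]`. -/
def orbitCount {H Γ : Subgroup G} (l w : G ⧸ H → ℝ) (C : ℝ → ℝ) (R : ℝ) (y : G ⧸ Γ) : ℝ≥0∞ :=
  orbitSum H (ballWeight l w R) y / ENNReal.ofReal (C R)

theorem ballWeight_mono {H : Subgroup G} (l w : G ⧸ H → ℝ) {R S : ℝ} (hRS : R ≤ S) (x : G ⧸ H) :
    ballWeight l w R x ≤ ballWeight l w S x :=
  Set.indicator_le_indicator_of_subset (fun _ hx => le_trans hx hRS) (fun _ => zero_le) x

theorem summable_and_weightedCount_eq {H Γ : Subgroup G} {l w : G ⧸ H → ℝ} (hw : ∀ x, 0 < w x)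
    {C : ℝ → ℝ} {R : ℝ} {y : G ⧸ Γ} (hy : orbitSum H (ballWeight l w R) y ≠ ∞) :
    (Summable fun x : ↥(orbitPoints H y ∩ heightBall l R) => w x) ∧
      (0 < C R → weightedCount l w C R y = (orbitCount l w C R y).toReal) := by
  rw [ballWeight, orbitSum_indicator] at hy
  have htoReal : ∀ x, (ENNReal.ofReal (w x)).toReal = w x := fun x =>
    ENNReal.toReal_ofReal (hw x).le
  refine ⟨?_, fun hCR => ?_⟩
  · simpa only [htoReal] using ENNReal.summable_toReal hy
  · rw [weightedCount, orbitCount, ballWeight, orbitSum_indicator, ENNReal.toReal_div,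
      ENNReal.tsum_toReal_eq (fun _ => ENNReal.ofReal_ne_top), ENNReal.toReal_ofReal hCR.le]
    simp only [htoReal]
    ring

/-- Pointwise convergence of `orbitCount` to a finite limit, in terms of real numbers. -/
theorem summable_and_tendsto_weightedCount {H Γ : Subgroup G} {l w : G ⧸ H → ℝ}
    (hw : ∀ x, 0 < w x) {C : ℝ → ℝ} (hC : ∀ R, 1 ≤ R → 0 < C R) {y : G ⧸ Γ} {c : ℝ} (hc : 0 ≤ c)
    (h : Tendsto (fun R => orbitCount l w C R y) atTop (𝓝 (ENNReal.ofReal c))) :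
    (∀ R : ℝ, Summable fun x : ↥(orbitPoints H y ∩ heightBall l R) => w x) ∧
      Tendsto (fun R => weightedCount l w C R y) atTop (𝓝 c) := by
  have hfin : ∀ᶠ R in atTop, orbitSum H (ballWeight l w R) y ≠ ∞ := by
    filter_upwards [h.eventually_lt_const (ENNReal.ofReal_lt_top (r := c))] with R hR htop
    rw [orbitCount, htop, ENNReal.top_div_of_ne_top ENNReal.ofReal_ne_top] at hR
    exact lt_irrefl _ hR
  constructor
  · intro R
    obtain ⟨S, hS, hRS⟩ := (hfin.and (eventually_ge_atTop R)).exists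
    exact (summable_and_weightedCount_eq (C := C) hw
      (ne_top_of_le_ne_top hS (orbitSum_mono (ballWeight_mono l w hRS) y))).1
  · have := (ENNReal.tendsto_toReal ENNReal.ofReal_ne_top).comp h
    rw [ENNReal.toReal_ofReal hc] at this
    refine this.congr' ?_
    filter_upwards [hfin, eventually_ge_atTop 1] with R hR hR1
    exact ((summable_and_weightedCount_eq hw hR).2 (hC R hR1)).symm

end Counting

/-! ### Slow variation and weak-* convergence of the orbit counts -/

section Group

variable {G : Type*} [Group G] [TopologicalSpace G] [IsTopologicalGroup G]

theorem image_smul_mem_nhds {K : Subgroup G} {O : Set G} (hO : O ∈ 𝓝 (1 : G)) (x : G ⧸ K) :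
    (fun g : G => g • x) '' O ∈ 𝓝 x := by
  obtain ⟨a, rfl⟩ := QuotientGroup.mk_surjective x
  have hopen : IsOpenMap fun g : G => ((g * a : G) : G ⧸ K) :=
    QuotientGroup.isOpenMap_coe.comp (isOpenMap_mul_right a)
  have := hopen.image_mem_nhds hO
  rwa [one_mul] at this

theorem IsSlowlyVarying.continuous {H : Subgroup G} {w : G ⧸ H → ℝ} (hw_pos : ∀ x, 0 < w x)
    (hw : IsSlowlyVarying w) : Continuous w := by
  refine continuous_iff_continuousAt.mpr fun x => Metric.continuousAt_iff'.mpr fun δ hδ => ?_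
  have hx := hw_pos x
  -- The bound 1/2 gives `w (g • x) ≤ 2 * w x`; the other bound then keeps the difference at most
  -- δ/2.
  set ε : ℝ := min (1 / 2) (δ / (4 * w x)) with hε
  have hε0 : 0 < ε := by positivity
  have hε1 : ε ≤ 1 / 2 := min_le_left _ _
  have hε2 : ε * (4 * w x) ≤ δ := (le_div_iff₀ (by positivity)).mp (min_le_right _ _)
  obtain ⟨O, hO, h1, h⟩ := hw ε hε0
  filter_upwards [image_smul_mem_nhds (hO.mem_nhds h1) x]
  rintro _ ⟨g, hg, rfl⟩
  obtain ⟨h2, h3⟩ := h x g hg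
  have hgx := hw_pos (g • x)
  have h4 : w (g • x) ≤ 2 * w x := by nlinarith
  have h5 : ε * w (g • x) ≤ ε * (2 * w x) := by gcongr
  simp only [Real.dist_eq, abs_lt]
  constructor <;> nlinarith

/-- If gx ∈ B_R, then x ∈ g⁻¹B_R ⊆ B_{(1+ε)R} and w(gx) ≤ (1+ε) w(x). Summing over the orbit and
changing the normalization costs the factor `K` in total. -/
theorem isSlowlyVaryingFamily_orbitCount [MeasurableSpace G] {H Γ : Subgroup G}
    {mGH : Measure (G ⧸ H)} {l w : G ⧸ H → ℝ} {C : ℝ → ℝ} (hwr : IsStronglyWellRounded mGH l)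
    (hw : IsSlowlyVarying w) (hC : HasPolynomialAsymptotic C) :
    IsSlowlyVaryingFamily (orbitCount (Γ := Γ) l w C) := by
  intro K hK y
  obtain ⟨ε, hε0, hε1, hratio⟩ := hC.exists_ratio_le hK
  obtain ⟨O₁, hO₁, hO₁1, -, hball⟩ := hwr ε hε0 hε1
  obtain ⟨O₂, hO₂, hO₂1, hweight⟩ := hw ε hε0
  set O : Set G := O₁ ∩ O₂
  have hO : O ∈ 𝓝 (1 : G) := inter_mem (hO₁.mem_nhds hO₁1) (hO₂.mem_nhds hO₂1)
  have ha : 0 < 1 + ε := by linarith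
  have key : ∀ R : ℝ, 1 < R → ∀ g : G, g⁻¹ ∈ O → ∀ z : G ⧸ Γ,
      orbitSum H (ballWeight l w R) (g • z) ≤
        ENNReal.ofReal (1 + ε) * orbitSum H (ballWeight l w ((1 + ε) * R)) z := by
    intro R hR g hg z
    rw [orbitSum_smul, ← orbitSum_const_mul]
    refine orbitSum_mono (fun x => ?_) z
    by_cases hx : g • x ∈ heightBall l R
    · have hx' : x ∈ heightBall l ((1 + ε) * R) := by
        refine (hball R hR).2.2 (Set.mem_biUnion hg.1 ?_)
        exact ⟨g • x, hx, inv_smul_smul g x⟩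
      rw [ballWeight, ballWeight, Set.indicator_of_mem hx, Set.indicator_of_mem hx',
        ← ENNReal.ofReal_mul ha.le]
      refine ENNReal.ofReal_le_ofReal ?_
      simpa using (hweight (g • x) g⁻¹ hg.2).2
    · rw [ballWeight, Set.indicator_of_notMem hx]
      exact zero_le
  -- The two inequalities use g⁻¹ and g respectively, hence the symmetrized neighbourhood.
  refine ⟨1 + ε, ha, _, image_smul_mem_nhds (inter_mem hO (inv_mem_nhds_one G hO)) y, ?_⟩
  have hta : Tendsto (fun R : ℝ => (1 + ε) * R) atTop atTop := tendsto_id.const_mul_atTop ha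
  filter_upwards [hratio, eventually_gt_atTop 1, hta.eventually (eventually_ge_atTop 1)]
    with R hR hR1 hR1'
  have hCR := hC.1 R hR1.le
  have hCR' := hC.1 _ hR1'
  have hcoef : ENNReal.ofReal (1 + ε) / ENNReal.ofReal (C R) ≤
      ENNReal.ofReal K / ENNReal.ofReal (C ((1 + ε) * R)) := by
    rw [← ENNReal.ofReal_div_of_pos hCR, ← ENNReal.ofReal_div_of_pos hCR']
    refine ENNReal.ofReal_le_ofReal ?_
    rwa [div_le_div_iff₀ hCR hCR']
  have step : ∀ z z' : G ⧸ Γ, orbitSum H (ballWeight l w R) z ≤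
      ENNReal.ofReal (1 + ε) * orbitSum H (ballWeight l w ((1 + ε) * R)) z' →
      orbitCount l w C R z ≤ ENNReal.ofReal K * orbitCount l w C ((1 + ε) * R) z' := by
    intro z z' h
    set s := orbitSum H (ballWeight l w ((1 + ε) * R)) z'
    calc orbitCount l w C R z ≤ ENNReal.ofReal (1 + ε) * s / ENNReal.ofReal (C R) := by
          rw [orbitCount]
          gcongr
      _ = ENNReal.ofReal (1 + ε) / ENNReal.ofReal (C R) * s := by
          simp only [div_eq_mul_inv]
          ring
      _ ≤ ENNReal.ofReal K / ENNReal.ofReal (C ((1 + ε) * R)) * s := by gcongr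
      _ = _ := by
          simp only [orbitCount, div_eq_mul_inv, s]
          ring
  rintro _ ⟨g, ⟨hg, hg'⟩, rfl⟩
  refine ⟨step _ _ (key R hR1 g hg' y), step _ _ ?_⟩
  have := key R hR1 g⁻¹ (by simpa using hg) (g • y)
  rwa [inv_smul_smul] at this

variable [T2Space G] [LocallyCompactSpace G] [SecondCountableTopology G]
    [MeasurableSpace G] [BorelSpace G] {H Γ : Subgroup G} [IsClosed (H : Set G)]
    [DiscreteTopology Γ] {mG : Measure G} {mH : Measure H} {mGH : Measure (G ⧸ H)}
    {mGΓ mHΓ : Measure (G ⧸ Γ)}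

theorem measurable_orbitCount {l w : G ⧸ H → ℝ} (hl : Continuous l) (hw : Continuous w)
    (C : ℝ → ℝ) (R : ℝ) : Measurable (orbitCount (Γ := Γ) l w C R) := by
  have := borelSpace_quotient H
  have hB : MeasurableSet (heightBall l R) := (isClosed_le hl continuous_const).measurableSet
  exact (measurable_orbitSum (hw.measurable.ennreal_ofReal.indicator hB)).div_const _

/-- Unfolding turns integrals against μ_R into integrals of the orbit count. Integrability of φ is
needed here, since otherwise its Bochner integral would be 0 and say nothing about the lower
integral. -/
theorem InvariantMeasures.lintegralTendstoOn (hm : InvariantMeasures H Γ mG mH mGH mGΓ mHΓ)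
    {l w : G ⧸ H → ℝ} (hl : Continuous l) (hw : Continuous w) {C : ℝ → ℝ}
    (hC : ∀ R, 1 ≤ R → 0 < C R) {μ : Measure (G ⧸ Γ)} [IsLocallyFiniteMeasure μ]
    {U : Set (G ⧸ Γ)} (hμ : WeakStarTendstoOn U (averagedTranslates mGH mHΓ l w C) μ) :
    LIntegralTendstoOn U mGΓ (orbitCount l w C) μ := by
  intro φ hφ hφc hφU hφ0
  have := borelSpace_quotient Γ
  obtain ⟨hint, hlim⟩ := hμ φ hφ hφc hφU
  rw [← ofReal_integral_eq_lintegral_ofReal (hφ.integrable_of_hasCompactSupport hφc)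
    (Eventually.of_forall hφ0)]
  refine ((ENNReal.continuous_ofReal.tendsto _).comp hlim).congr' ?_
  filter_upwards [hint, eventually_ge_atTop 1] with R hR hR1
  rw [Function.comp_apply, ofReal_integral_eq_lintegral_ofReal hR (Eventually.of_forall hφ0)]
  exact (hm.lintegral_averagedTranslates hl hw (hC R hR1) hφ.measurable.ennreal_ofReal).symm

end Group

end OrbitCounting

end

open OrbitCounting

theorem mainTheorem9 {G : Type*} [Group G] [TopologicalSpace G] [IsTopologicalGroup G]
    [T2Space G] [LocallyCompactSpace G] [SecondCountableTopology G]
    [MeasurableSpace G] [BorelSpace G]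
    (H Γ : Subgroup G) (hH : IsClosed (H : Set G)) (hΓ : DiscreteTopology Γ)
    (mG : Measure G) (mH : Measure H) (mGH : Measure (G ⧸ H)) (mGΓ mHΓ : Measure (G ⧸ Γ))
    (hm : OrbitCounting.InvariantMeasures H Γ mG mH mGH mGΓ mHΓ)
    (l : G ⧸ H → ℝ) (hl : Continuous l) (hl_pos : ∀ x, 0 < l x)
    (hl_fin : ∀ R : ℝ, 0 < R → mGH (OrbitCounting.heightBall l R) < ∞)
    (hwr : OrbitCounting.IsStronglyWellRounded mGH l)
    (w : G ⧸ H → ℝ) (hw_pos : ∀ x, 0 < w x) (hw : OrbitCounting.IsSlowlyVarying w)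
    (C : ℝ → ℝ) (hC : OrbitCounting.HasPolynomialAsymptotic C)
    (μ : Measure (G ⧸ Γ)) [IsLocallyFiniteMeasure μ] :
    (μ ≠ 0 →
      OrbitCounting.WeakStarTendstoOn Set.univ
        (OrbitCounting.averagedTranslates mGH mHΓ l w C) μ →
      ∃ f : G ⧸ Γ → ℝ, Continuous f ∧ (∀ y, 0 ≤ f y) ∧
        (ConnectedSpace (G ⧸ Γ) → ∀ y, 0 < f y) ∧
        μ = mGΓ.withDensity (fun y => ENNReal.ofReal (f y)) ∧
        ∀ y : G ⧸ Γ,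
          (∀ R : ℝ, Summable fun x :
            ↥(OrbitCounting.orbitPoints H y ∩ OrbitCounting.heightBall l R) => w x) ∧
          Tendsto (fun R => OrbitCounting.weightedCount l w C R y) atTop (𝓝 (f y))) ∧
    (∀ U : Set (G ⧸ Γ), IsOpen U → ((1 : G) : G ⧸ Γ) ∈ U →
      OrbitCounting.WeakStarTendstoOn U
        (OrbitCounting.averagedTranslates mGH mHΓ l w C) μ →
      ∃ f : G ⧸ Γ → ℝ, ContinuousOn f U ∧ (∀ y ∈ U, 0 ≤ f y) ∧
        μ.restrict U = (mGΓ.restrict U).withDensity (fun y => ENNReal.ofReal (f y)) ∧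
        ∀ y ∈ U,
          (∀ R : ℝ, Summable fun x :
            ↥(OrbitCounting.orbitPoints H y ∩ OrbitCounting.heightBall l R) => w x) ∧
          Tendsto (fun R => OrbitCounting.weightedCount l w C R y) atTop (𝓝 (f y))) := by
  have hHc : IsClosed (H : Set G) := hH
  have := borelSpace_quotient Γ
  have := hm.locallyFinite_GΓ
  have := hm.isOpenPosMeasure_GΓ
  have hwc := hw.continuous hw_pos
  have hN : IsSlowlyVaryingFamily (orbitCount (Γ := Γ) l w C) :=
    isSlowlyVaryingFamily_orbitCount hwr hw hC
  have hNm := measurable_orbitCount (Γ := Γ) hl hwc C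
  refine ⟨fun hμ0 hμ => ?_, fun U hU _ hμ => ?_⟩
  · obtain ⟨f, hfc, hf0, hfμ, hf⟩ :=
      hN.exists_density hNm (hm.lintegralTendstoOn hl hwc hC.1 hμ) isOpen_univ
    rw [continuousOn_univ] at hfc
    rw [Measure.restrict_univ, Measure.restrict_univ] at hfμ
    refine ⟨f, hfc, hf0, fun _ => ?_, hfμ, fun y =>
      summable_and_tendsto_weightedCount hw_pos hC.1 (hf0 y) (hf y trivial)⟩
    obtain ⟨x, hx⟩ : ∃ x, f x ≠ 0 := by
      by_contra! h
      exact hμ0 (by simp [hfμ, h])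
    exact hN.pos_of_connected hfc hf0 (fun y => hf y trivial) hx
  · obtain ⟨f, hfc, hf0, hfμ, hf⟩ :=
      hN.exists_density hNm (hm.lintegralTendstoOn hl hwc hC.1 hμ) hU
    exact ⟨f, hfc, fun y _ => hf0 y, hfμ, fun y hy =>
      summable_and_tendsto_weightedCount hw_pos hC.1 (hf0 y) (hf y hy)⟩
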